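/- Let $F$ be a $*$-subfield of $\mathbb{C}$ (a subfield closed under complex conjugation $^*$), let $d\ge 3$, and equip $F^d$ with the standard form $\langle x|y\rangle=\sum_i x_i^*y_i$. Let $\mathsf L=\mathsf L(F^d)$ be the lattice of linear subspaces of $F^d$ with the involution $U\mapsto U^\perp$; lattice terms are built from variables by $+$, $0$ and $^\perp$. An orthonormal frame is a family $\bar a=(a_{ij})_{1\le i,j\le d}$ in $\mathsf L$ of the form $a_{ii}=v_iF$, $a_{ij}=(v_j-v_i)F$ ($i\ne j$) for some orthogonal basis $v_1,\dots,v_d$ of $F^d$ with $\langle v_i|v_i\rangle=\langle v_j|v_j\rangle$ for all $i,j$. Put $R_{21}(\bar a)=\{u\in\mathsf L\mid u\oplus a_{22}=a_{22}+a_{11}\}$; it is identified with $F$ via $\omega(r)=(v_1-rv_2)F$. For a condition $\varphi(x_1,\dots,x_n)$ on elements of $F$, let $M_\varphi=M_\varphi(F)$ be the set of all $(\bar a,\bar b)$ such that $\bar a$ is an orthonormal frame and $\bar b=(\omega(r_1),\dots,\omega(r_n))\in R_{21}(\bar a)^n$ for some $\bar r\in F^n$ satisfying $\varphi$. For $0<k\le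 d$ let $\Gamma^d_k(F)$ be the set of all Grassmann-Plücker coordinate vectors of $k$-dimensional subspaces of $F^d$ (all nonzero multiples of the vector of $k\times k$-minors of a matrix whose $k$ columns form a basis), and let $\Gamma^d_0(F)=\{0\}$. For a set $M$ of tuples of subspaces let $\theta(M)$ be the set of all tuples $(\underline r_1,\underline r_2,\dots)$ such that the $\underline r_i$ are coordinate vectors, in the respective $\Gamma^d_{k_i}(F)$, of subspaces $U_i$ with $(U_1,U_2,\dots)\in M$. We consider first order formulas $\psi$ over the multi-sorted structure $\Gamma^d(F)$ with sorts $\Gamma^d_k(F)$, $0\le k\le d$: atomic formulas are equations $p=0$, where $p$ is a $*$-polynomial with integer coefficients in the coordinates of the variables (homogeneous or not), and quantifiers may range over the sorts $\Gamma^d_k(F)$ and over $F$. Then $\theta(M_\varphi)$ cannot be defined in $\Gamma^d(F)$ by any formula $\psi$ such that (i) $\psi$ is quantifier free and positive (built from equations by conjunction and disjunction); here $\varphi$ is $x\neq 0$; (ii) $\psi$ is a conjunction of equations and negated equations; here $\varphi$ is $x_1=0\Leftrightarrow x_2=0$; (iii) $\psi$ (possibly with quantifiers) does not involve the involution; here $\varphi$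 is $x_2=x_1^*$ and $F=\mathbb{C}$. Nevertheless, for each of these three conditions $\varphi$ (and each $F$), $M_\varphi$ is defined within $\mathsf L$ by a single equation $t=0$ with a lattice term $t$. -/

import Mathlib

open scoped Matrix

namespace FrameDef

section Lattice

variable (F : Type*) [Field F] [StarRing F] (d : ℕ)

/-- The lattice of all linear subspaces of `F^d`. -/
abbrev Lat : Type _ := Submodule F (Fin d → F)

variable {F d}

/-- The standard `*`-hermitean form `⟨x | y⟩ = ∑ i, (x i)^* * y i`. -/
def form (x y : Fin d → F) : F := ∑ i, star (x i) * y i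

/-- The orthogonal `U^⊥ = {x | ∀ u ∈ U, ⟨x | u⟩ = 0}`, the involution of the lattice. -/
def perp (U : Lat F d) : Lat F d where
  carrier := {x | ∀ u ∈ U, form x u = 0}
  zero_mem' := by
    intro u _
    simp [form]
  add_mem' := by
    intro x y hx hy u hu
    have h1 : form (x + y) u = form x u + form y u := by
      simp [form, add_mul, Finset.sum_add_distrib]
    rw [h1, hx u hu, hy u hu, add_zero]
  smul_mem' := by
    intro c x hx u hu
    have h1 : form (c • x) u = star c * form x u := by
      simp only [form, Finset.mul_sum, Pi.smul_apply, smul_eq_mul, star_mul]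
      exact Finset.sum_congr rfl (fun i _ => by ring)
    rw [h1, hx u hu, mul_zero]

/-- Terms in the language of bounded lattices with involution, in the signature `+, 0, ⊥`
(meet and `1` are the derived operations `(s^⊥ + t^⊥)^⊥` and `0^⊥`). -/
inductive LatTerm (V : Type) : Type
  | var : V → LatTerm V
  | zero : LatTerm V
  | perp : LatTerm V → LatTerm V
  | join : LatTerm V → LatTerm V → LatTerm V

/-- The value of a term in the lattice of subspaces. -/
def LatTerm.eval {V : Type} (u : V → Lat F d) : LatTerm V → Lat F d
  | .var v => u v
  | .zero => ⊥
  | .perp t => FrameDef.perp (t.eval u)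
  | .join s t => s.eval u ⊔ t.eval u

/-- A set of tuples of subspaces is defined by a single equation `t = 0`. -/
def DefinedByEquation {V : Type} (M : Set (V → Lat F d)) : Prop :=
  ∃ t : LatTerm V, M = {u | t.eval u = ⊥}

/-- Frames of the lattice; `a (i, i)` is written `a_i`. -/
structure IsFrame (a : Fin d × Fin d → Lat F d) : Prop where
  indep : iSupIndep fun i => a (i, i)
  sup_eq : ⨆ i, a (i, i) = ⊤
  symm : ∀ i j, i ≠ j → a (i, j) = a (j, i)
  sup_axis : ∀ i j, i ≠ j → a (i, i) ⊔ a (j, j) = a (i, i) ⊔ a (i, j)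
  disj_axis : ∀ i j, i ≠ j → a (i, i) ⊓ a (i, j) = ⊥
  triangle : ∀ i j k, i ≠ j → i ≠ k → j ≠ k →
    a (i, k) = (a (i, i) ⊔ a (k, k)) ⊓ (a (i, j) ⊔ a (j, k))

/-- The frame corresponding to a basis: `a_i = v_i F` and `a_ij = (v_j - v_i) F`. -/
def frameOf (v : Module.Basis (Fin d) F (Fin d → F)) : Fin d × Fin d → Lat F d :=
  fun p => if p.1 = p.2 then Submodule.span F {v p.1} else Submodule.span F {v p.2 - v p.1}

/-- Orthogonal bases all of whose members have the same form value `⟨v_i | v_i⟩`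
(that is, `⟨v_1 | v_1⟩⁻¹ ⟨v_i | v_i⟩ = 1` for all `i`). -/
def IsAlphaBasis (v : Module.Basis (Fin d) F (Fin d → F)) : Prop :=
  (∀ i j, i ≠ j → form (v i) (v j) = 0) ∧ ∀ i j, form (v i) (v i) = form (v j) (v j)

/-- Frames that come from such a basis (orthonormal frames). -/
def IsAlphaFrame (a : Fin d × Fin d → Lat F d) : Prop :=
  IsFrame a ∧ ∃ v : Module.Basis (Fin d) F (Fin d → F), IsAlphaBasis v ∧ a = frameOf v

/-- The first index (the index set `1, ..., d` is `Fin d`). -/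
def idx1 (hd : 3 ≤ d) : Fin d := ⟨0, by omega⟩

/-- The second index. -/
def idx2 (hd : 3 ≤ d) : Fin d := ⟨1, by omega⟩

/-- `R_21(a)`: the complements of `a_2` in the interval from `0` to `a_2 + a_1`. -/
def R21 (hd : 3 ≤ d) (a : Fin d × Fin d → Lat F d) : Set (Lat F d) :=
  {u | u ⊔ a (idx2 hd, idx2 hd) = a (idx2 hd, idx2 hd) ⊔ a (idx1 hd, idx1 hd) ∧
    u ⊓ a (idx2 hd, idx2 hd) = ⊥}

/-- The coordinate map `r ↦ (v_1 - r v_2) F` from `F` onto `R_21`. -/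
def omega21 (hd : 3 ≤ d) (v : Module.Basis (Fin d) F (Fin d → F)) (r : F) : Lat F d :=
  Submodule.span F {v (idx1 hd) - r • v (idx2 hd)}

/-- `M_φ`: the pairs `(a, b)` where `a` is an orthonormal frame and `b` is an `n`-tuple in
`R_21(a)` which satisfies `φ` when `R_21(a)` is identified with `F` (the identification
`omega21` depends on `a` only, since the basis is determined by `a` up to one scalar). -/
def MSet (hd : 3 ≤ d) {n : ℕ} (φ : (Fin n → F) → Prop) :
    Set ((Fin d × Fin d) ⊕ Fin n → Lat F d) :=
  {u | IsAlphaFrame (fun p => u (Sum.inl p)) ∧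
    (∀ k, u (Sum.inr k) ∈ R21 hd (fun p => u (Sum.inl p))) ∧
    ∃ v : Module.Basis (Fin d) F (Fin d → F), (fun p => u (Sum.inl p)) = frameOf v ∧
      ∃ r : Fin n → F, φ r ∧ ∀ k, u (Sum.inr k) = omega21 hd v (r k)}

end Lattice

section Pluecker

variable {F : Type*} [Field F] {d : ℕ}

/-- The vector of all `k × k`-subdeterminants of `A` with columns `j`; the index set `I_k` of
strictly increasing `k`-tuples is `Fin k ↪o Fin d`. -/
def minors (k : ℕ) (A : Matrix (Fin d) (Fin d) F) (j : Fin k ↪o Fin d) : (Fin k ↪o Fin d) → F :=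
  fun i => (A.submatrix i j).det

/-- The Grassmann-Pluecker coordinates of (the column space of) a matrix of rank `k`:
the nonzero vectors in the span of the vectors of minors; by convention `{0}` if `k = 0`. -/
def plueckerSet (k : ℕ) (A : Matrix (Fin d) (Fin d) F) : Set ((Fin k ↪o Fin d) → F) :=
  if k = 0 then {0} else {r | r ∈ Submodule.span F (Set.range (minors k A)) ∧ r ≠ 0}

/-- `Γ_k^d(F)`. -/
def Grass (F : Type*) [Field F] (d k : ℕ) : Set ((Fin k ↪o Fin d) → F) :=
  {r | ∃ A : Matrix (Fin d) (Fin d) F, A.rank = k ∧ r ∈ plueckerSet k A}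

/-- `r` is a vector of Grassmann-Pluecker coordinates of the `k`-dimensional subspace `U`. -/
def IsPlueckerOf (k : ℕ) (U : Submodule F (Fin d → F)) (r : (Fin k ↪o Fin d) → F) : Prop :=
  ∃ A : Matrix (Fin d) (Fin d) F, A.rank = k ∧
    Submodule.span F (Set.range fun j i => A i j) = U ∧ r ∈ plueckerSet k A

end Pluecker

section Formulas

/-- Sorts: one for each `Γ_k^d(F)`, `0 ≤ k ≤ d`, and one for the field `F` itself. -/
inductive Srt (d : ℕ) : Type
  | scalar : Srt d
  | gr : Fin (d + 1) → Srt d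

/-- The index set of the coordinates of the elements of a sort. -/
def Srt.Coord {d : ℕ} : Srt d → Type
  | .scalar => Unit
  | .gr k => Fin (k : ℕ) ↪o Fin d

/-- The domain of a sort. -/
def Srt.Dom (F : Type*) [Field F] {d : ℕ} : (s : Srt d) → Set (s.Coord → F)
  | .scalar => Set.univ
  | .gr k => Grass F d k

/-- `*`-polynomials with integer coefficients in variables from `C`;
`Sum.inl c` stands for the variable `c`, `Sum.inr c` for `c^*`. -/
abbrev StarPoly (C : Type) : Type := MvPolynomial (C ⊕ C) ℤ

/-- The value of a `*`-polynomial. -/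
noncomputable def StarPoly.value {C : Type} {F : Type*} [Field F] [StarRing F]
    (x : C → F) (p : StarPoly C) : F :=
  MvPolynomial.eval₂ (Int.castRingHom F) (Sum.elim x fun c => star (x c)) p

/-- First order formulas, in variables `v : V` of sort `s v`. Atomic formulas are the equations
`p = 0` for `*`-polynomials `p` (homogeneous or not) with integer coefficients in the coordinates
of the variables. A quantifier adds one variable, `none`, of a given sort. -/
inductive Fml (d : ℕ) : (V : Type) → (V → Srt d) → Type 1
  | eqn {V : Type} {s : V → Srt d} : StarPoly (Σ v, (s v).Coord) → Fml d V s
  | neg {V : Type} {s : V → Srt d} : Fml d V s → Fml d V s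
  | and {V : Type} {s : V → Srt d} : Fml d V s → Fml d V s → Fml d V s
  | or {V : Type} {s : V → Srt d} : Fml d V s → Fml d V s → Fml d V s
  | all {V : Type} {s : V → Srt d} (q : Srt d) : Fml d (Option V) (fun o => o.elim q s) → Fml d V s
  | ex {V : Type} {s : V → Srt d} (q : Srt d) : Fml d (Option V) (fun o => o.elim q s) → Fml d V s

/-- Extension of an assignment by a value for the new variable. -/
def extend {F : Type*} [Field F] {d : ℕ} {V : Type} {s : V → Srt d} {q : Srt d}
    (a : q.Dom F) (x : ∀ v, (s v).Dom F) : ∀ o : Option V, Srt.Dom F (o.elim q s)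
  | none => a
  | some v => x v

/-- Validity of a formula under an assignment. -/
def Fml.Holds {F : Type*} [Field F] [StarRing F] {d : ℕ} :
    {V : Type} → {s : V → Srt d} → Fml d V s → (∀ v, (s v).Dom F) → Prop
  | _, _, .eqn p, x => p.value (fun c => (x c.1).1 c.2) = 0
  | _, _, .neg ψ, x => ¬ ψ.Holds x
  | _, _, .and ψ χ, x => ψ.Holds x ∧ χ.Holds x
  | _, _, .or ψ χ, x => ψ.Holds x ∨ χ.Holds x
  | _, _, .all q ψ, x => ∀ a : q.Dom F, ψ.Holds (extend a x)
  | _, _, .ex q ψ, x => ∃ a : q.Dom F, ψ.Holds (extend a x)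

/-- Quantifier free and positive: built from equations by conjunction and disjunction. -/
def Fml.IsQFPositive {d : ℕ} : {V : Type} → {s : V → Srt d} → Fml d V s → Prop
  | _, _, .eqn _ => True
  | _, _, .and ψ χ => ψ.IsQFPositive ∧ χ.IsQFPositive
  | _, _, .or ψ χ => ψ.IsQFPositive ∧ χ.IsQFPositive
  | _, _, .neg _ => False
  | _, _, .all _ _ => False
  | _, _, .ex _ _ => False

/-- Conjunctions of equations and negated equations. -/
def Fml.IsLiteralConj {d : ℕ} : {V : Type} → {s : V → Srt d} → Fml d V s → Prop
  | _, _, .eqn _ => True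
  | _, _, .neg (.eqn _) => True
  | _, _, .and ψ χ => ψ.IsLiteralConj ∧ χ.IsLiteralConj
  | _, _, _ => False

/-- The involution does not occur: every atomic formula is given by an ordinary polynomial. -/
def Fml.InvolutionFree {d : ℕ} : {V : Type} → {s : V → Srt d} → Fml d V s → Prop
  | _, _, .eqn p => ∃ q, p = MvPolynomial.rename Sum.inl q
  | _, _, .neg ψ => ψ.InvolutionFree
  | _, _, .and ψ χ => ψ.InvolutionFree ∧ χ.InvolutionFree
  | _, _, .or ψ χ => ψ.InvolutionFree ∧ χ.InvolutionFree
  | _, _, .all _ ψ => ψ.InvolutionFree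
  | _, _, .ex _ ψ => ψ.InvolutionFree

/-- `θ(M)`: the union, over all dimension vectors `δ`, of the sets `θ_δ(M)` of tuples `r` with
`r v ∈ Γ^d_{δ v}(F)` which are Grassmann-Pluecker coordinates of a member of `M`. -/
def theta {F : Type*} [Field F] {d : ℕ} {V : Type} (M : Set (V → Submodule F (Fin d → F))) :
    Set (Σ δ : V → Fin (d + 1), ∀ v, (Srt.gr (δ v)).Dom F) :=
  {r | ∃ u ∈ M, ∀ v, IsPlueckerOf (r.1 v : ℕ) (u v) (r.2 v).1}

/-- The formula `ψ` in variables of sorts `Γ^d_{δ v}(F)` defines the relation `S`. -/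
def Fml.Defines {F : Type*} [Field F] [StarRing F] {d : ℕ} {V : Type} {δ : V → Fin (d + 1)}
    (ψ : Fml d V fun v => Srt.gr (δ v))
    (S : Set (Σ δ : V → Fin (d + 1), ∀ v, (Srt.gr (δ v)).Dom F)) : Prop :=
  S = Sigma.mk δ '' {x | ψ.Holds x}

end Formulas

end FrameDef

open FrameDef

/-! Undefinability. On the standard frame, the elements `ω(r)` have coordinate vectors affine in
`r`, and this tuple lies in `θ(M_φ)` exactly when `φ r` holds (`testPoint_mem_theta_iff`). A formula
defining `θ(M_φ)` therefore yields one for `φ` itself, and each syntactic class is defeated by an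
invariant. (i) A `*`-polynomial restricted to natural parameters is an ordinary polynomial, since
naturals are fixed by `star`. Positive conditions are thus closed: true at infinitely many naturals,
they are true at `0`, unlike `x ≠ 0`. (ii) On the grid of naturals, equations valid off the axes
extend to the axes, while a negated equation valid at the origin fails at only finitely many points
of an axis. So a conjunction of both kinds would hold at some `(n, 0)` with `n ≠ 0`. (iii)
Involution-free formulas are invariant under field automorphisms, and some automorphism of `ℂ` does
not commute with conjugation.

Definability. The form is anisotropic, so `⊥` is an orthocomplement: meets are terms, and inclusions
and finite conjunctions reduce to single equations `t = 0`. Frames come from bases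
(`IsFrame.exists_basis`), and equality of norms is the orthogonality of `v_j - v_i` and `v_i + v_j`.
The conditions on `r` become statements about `ω(r) ∩ a_1`, and for the involution the orthogonality
of `v_1 - r v_2` and `s v_1 + v_2`, whose line is constructed by perspectivities. -/

namespace FrameDef

/-! ### Anisotropic forms and orthocomplements -/

section Orthogonality

variable {F : Type*} [Field F] [StarRing F] {d : ℕ}

theorem form_add_left (x y z : Fin d → F) : form (x + y) z = form x z + form y z := by
  simp [form, add_mul, Finset.sum_add_distrib]

theorem form_add_right (x y z : Fin d → F) : form x (y + z) = form x y + form x z := by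
  simp [form, mul_add, Finset.sum_add_distrib]

theorem form_smul_left (c : F) (x y : Fin d → F) : form (c • x) y = star c * form x y := by
  simp only [form, Finset.mul_sum, Pi.smul_apply, smul_eq_mul, star_mul]
  exact Finset.sum_congr rfl fun i _ => by ring

theorem form_smul_right (c : F) (x y : Fin d → F) : form x (c • y) = c * form x y := by
  simp only [form, Finset.mul_sum, Pi.smul_apply, smul_eq_mul]
  exact Finset.sum_congr rfl fun i _ => by ring

theorem form_sub_left (x y z : Fin d → F) : form (x - y) z = form x z - form y z := by
  simp [form, sub_mul, Finset.sum_sub_distrib]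

theorem form_sub_right (x y z : Fin d → F) : form x (y - z) = form x y - form x z := by
  simp [form, mul_sub, Finset.sum_sub_distrib]

theorem star_form (x y : Fin d → F) : star (form x y) = form y x := by
  simp [form, star_sum, mul_comm]

theorem form_eq_zero_comm {x y : Fin d → F} : form x y = 0 ↔ form y x = 0 := by
  rw [← star_form, star_eq_zero]

theorem mem_perp {U : Lat F d} {x : Fin d → F} : x ∈ perp U ↔ ∀ u ∈ U, form x u = 0 := Iff.rfl

theorem span_singleton_le_perp_span_singleton {x y : Fin d → F} :
    Submodule.span F {x} ≤ perp (Submodule.span F {y}) ↔ form x y = 0 := by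
  rw [Submodule.span_singleton_le_iff_mem, mem_perp]
  refine ⟨fun h => h y (Submodule.mem_span_singleton_self y), fun h u hu => ?_⟩
  obtain ⟨c, rfl⟩ := Submodule.mem_span_singleton.1 hu
  rw [form_smul_right, h, mul_zero]

theorem le_perp_comm {U W : Lat F d} : U ≤ perp W ↔ W ≤ perp U :=
  ⟨fun h _ hw _ hu => form_eq_zero_comm.1 (h hu _ hw),
    fun h _ hu _ hw => form_eq_zero_comm.1 (h hw _ hu)⟩

theorem le_perp_perp (U : Lat F d) : U ≤ perp (perp U) := le_perp_comm.1 le_rfl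

theorem perp_sup (U W : Lat F d) : perp (U ⊔ W) = perp U ⊓ perp W := by
  refine eq_of_forall_le_iff fun X => ?_
  rw [le_perp_comm, sup_le_iff, le_inf_iff, le_perp_comm (U := U), le_perp_comm (U := W)]

/-- The form is anisotropic. -/
def Anisotropic (F : Type*) [Field F] [StarRing F] (d : ℕ) : Prop :=
  ∀ x : Fin d → F, form x x = 0 → x = 0

/-- In `ℂ` the value `⟨x | x⟩` becomes a sum of squared moduli. -/
theorem anisotropic_of_embedding (ι : F →+* ℂ) (hι : ∀ x : F, ι (star x) = star (ι x)) :
    Anisotropic F d := by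
  intro x hx
  have h1 : ∑ i, Complex.normSq (ι (x i)) = 0 := by
    have h2 : ι (form x x) = ((∑ i, Complex.normSq (ι (x i)) : ℝ) : ℂ) := by
      rw [form, map_sum, Complex.ofReal_sum]
      refine Finset.sum_congr rfl fun i _ => ?_
      rw [map_mul, hι, Complex.normSq_eq_conj_mul_self]
      rfl
    rw [hx, map_zero] at h2
    exact_mod_cast h2.symm
  funext i
  have h3 := (Finset.sum_eq_zero_iff_of_nonneg fun i _ => Complex.normSq_nonneg (ι (x i))).1 h1 i
    (Finset.mem_univ i)
  simpa using h3

theorem Anisotropic.inf_perp (h : Anisotropic F d) (U : Lat F d) : U ⊓ perp U = ⊥ :=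
  (Submodule.eq_bot_iff _).2 fun x hx => h x (hx.2 x hx.1)

/-- Dimension count: `U^⊥` contains the kernel of a map into `F ^ dim U`, so its dimension is at
least `d - dim U`, and it meets `U` trivially. -/
theorem Anisotropic.sup_perp (h : Anisotropic F d) (U : Lat F d) : U ⊔ perp U = ⊤ := by
  obtain ⟨b⟩ : Nonempty (Module.Basis (Fin (Module.finrank F U)) F U) :=
    ⟨Module.finBasis F U⟩
  let L : (Fin d → F) →ₗ[F] (Fin (Module.finrank F U) → F) :=
    { toFun := fun x j => form (b j : Fin d → F) x
      map_add' := fun x y => funext fun j => form_add_right _ _ _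
      map_smul' := fun c x => funext fun j => form_smul_right _ _ _ }
  have hker : LinearMap.ker L ≤ perp U := by
    intro x hx u hu
    have hx' : ∀ j, form (b j : Fin d → F) x = 0 := fun j => congrFun (LinearMap.mem_ker.1 hx) j
    have hb : ((∑ j, b.repr ⟨u, hu⟩ j • b j : U) : Fin d → F) = u := by rw [b.sum_repr]
    rw [form_eq_zero_comm, ← hb]
    have : ∀ s : Finset (Fin (Module.finrank F U)),
        form ((∑ j ∈ s, b.repr ⟨u, hu⟩ j • b j : U) : Fin d → F) x = 0 := by
      intro s
      induction s using Finset.induction_on with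
      | empty => simp [form]
      | insert j s hj ih =>
        rw [Finset.sum_insert hj, Submodule.coe_add, Submodule.coe_smul, form_add_left, ih,
          form_smul_left, hx' j, mul_zero, add_zero]
    exact this _
  have h1 : Module.finrank F (LinearMap.range L) + Module.finrank F (LinearMap.ker L) = d := by
    rw [LinearMap.finrank_range_add_finrank_ker, Module.finrank_fin_fun]
  have h2 : Module.finrank F (LinearMap.range L) ≤ Module.finrank F U := by
    simpa using Submodule.finrank_le (LinearMap.range L)
  have h3 := Submodule.finrank_mono hker
  have h4 := Submodule.finrank_sup_add_finrank_inf_eq U (perp U)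
  rw [h.inf_perp, finrank_bot, add_zero] at h4
  have h5 := Submodule.finrank_le (U ⊔ perp U)
  rw [Module.finrank_fin_fun] at h5
  apply Submodule.eq_top_of_finrank_eq
  rw [Module.finrank_fin_fun]
  omega

theorem Anisotropic.perp_perp (h : Anisotropic F d) (U : Lat F d) : perp (perp U) = U := by
  refine le_antisymm (fun x hx => ?_) (le_perp_perp U)
  have : x ∈ U ⊔ perp U := by rw [h.sup_perp]; trivial
  obtain ⟨u, hu, w, hw, rfl⟩ := Submodule.mem_sup.1 this
  have hw' : w ∈ perp (perp U) := by
    have := Submodule.sub_mem _ hx (le_perp_perp U hu)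
    rwa [add_sub_cancel_left] at this
  have h0 : w ∈ perp U ⊓ perp (perp U) := ⟨hw, hw'⟩
  rw [h.inf_perp, Submodule.mem_bot] at h0
  rwa [h0, add_zero]

/-- Orthomodularity: the component in `U^⊥` of a vector of `W` stays in `W`, because `U ≤ W`. -/
theorem Anisotropic.le_of_inf_perp_eq_bot (h : Anisotropic F d) {U W : Lat F d} (hUW : U ≤ W)
    (h0 : W ⊓ perp U = ⊥) : W ≤ U := by
  intro x hx
  have : x ∈ U ⊔ perp U := by rw [h.sup_perp]; trivial
  obtain ⟨u, hu, w, hw, rfl⟩ := Submodule.mem_sup.1 this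
  have hw' : w ∈ W ⊓ perp U := by
    refine ⟨?_, hw⟩
    have := Submodule.sub_mem _ hx (hUW hu)
    rwa [add_sub_cancel_left] at this
  rw [h0, Submodule.mem_bot] at hw'
  rwa [hw', add_zero]

end Orthogonality

/-! ### Closure properties of terms and of equational conditions -/

section TermFunctions

variable {F : Type*} [Field F] [StarRing F] {d : ℕ} {V : Type}

/-- Functions on tuples of subspaces that are given by a lattice term. -/
def IsTermFun (f : (V → Lat F d) → Lat F d) : Prop :=
  ∃ t : LatTerm V, ∀ u, t.eval u = f u

/-- Properties of tuples of subspaces that are expressed by an equation `t = 0`. -/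
def IsEquational (P : (V → Lat F d) → Prop) : Prop :=
  ∃ t : LatTerm V, ∀ u, P u ↔ t.eval u = ⊥

theorem IsTermFun.var (v : V) : IsTermFun (fun u : V → Lat F d => u v) := ⟨.var v, fun _ => rfl⟩

theorem IsTermFun.bot : IsTermFun (fun _ : V → Lat F d => ⊥) := ⟨.zero, fun _ => rfl⟩

theorem IsTermFun.perp {f : (V → Lat F d) → Lat F d} (hf : IsTermFun f) :
    IsTermFun fun u => FrameDef.perp (f u) := by
  obtain ⟨t, ht⟩ := hf
  exact ⟨.perp t, fun u => by rw [LatTerm.eval, ht]⟩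

theorem IsTermFun.sup {f g : (V → Lat F d) → Lat F d} (hf : IsTermFun f) (hg : IsTermFun g) :
    IsTermFun fun u => f u ⊔ g u := by
  obtain ⟨t, ht⟩ := hf
  obtain ⟨s, hs⟩ := hg
  exact ⟨.join t s, fun u => by rw [LatTerm.eval, ht, hs]⟩

theorem IsTermFun.inf (h : Anisotropic F d) {f g : (V → Lat F d) → Lat F d} (hf : IsTermFun f)
    (hg : IsTermFun g) : IsTermFun fun u => f u ⊓ g u := by
  have := (hf.perp.sup hg.perp).perp
  simpa only [perp_sup, h.perp_perp] using this

theorem IsTermFun.top (h : Anisotropic F d) : IsTermFun (fun _ : V → Lat F d => ⊤) := by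
  have := (IsTermFun.bot (F := F) (d := d) (V := V)).sup IsTermFun.bot.perp
  simpa only [h.sup_perp] using this

theorem IsTermFun.iSup {ι : Type*} [Finite ι] {f : ι → (V → Lat F d) → Lat F d}
    (hf : ∀ i, IsTermFun (f i)) : IsTermFun fun u => ⨆ i, f i u := by
  have := Fintype.ofFinite ι
  have key : ∀ s : Finset ι, IsTermFun fun u => s.sup fun i => f i u := by
    intro s
    induction s using Finset.cons_induction with
    | empty => simpa using IsTermFun.bot
    | cons i s hi ih => simpa only [Finset.sup_cons] using (hf i).sup ih
  simpa only [Finset.sup_univ_eq_iSup] using key Finset.univ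

theorem IsTermFun.eq_bot {f : (V → Lat F d) → Lat F d} (hf : IsTermFun f) :
    IsEquational fun u => f u = ⊥ := by
  obtain ⟨t, ht⟩ := hf
  exact ⟨t, fun u => by rw [ht]⟩

/-- `U ≤ W` amounts to `U ∩ (U ∩ W)^⊥ = 0`. -/
theorem IsTermFun.le (h : Anisotropic F d) {f g : (V → Lat F d) → Lat F d} (hf : IsTermFun f)
    (hg : IsTermFun g) : IsEquational fun u => f u ≤ g u := by
  have := (hf.inf h (hf.inf h hg).perp).eq_bot
  convert this using 2 with u
  refine ⟨fun hle => ?_, fun h0 => ?_⟩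
  · rw [inf_eq_left.2 hle, h.inf_perp]
  · exact (h.le_of_inf_perp_eq_bot inf_le_left h0).trans inf_le_right

/-- A join vanishes exactly when all its members do. -/
theorem IsEquational.forall {ι : Type*} [Finite ι] {P : ι → (V → Lat F d) → Prop}
    (hP : ∀ i, IsEquational (P i)) : IsEquational fun u => ∀ i, P i u := by
  choose t ht using hP
  have key : ∀ i, IsTermFun fun u : V → Lat F d => (t i).eval u := fun i => ⟨t i, fun _ => rfl⟩
  have := (IsTermFun.iSup key).eq_bot
  simpa only [iSup_eq_bot, ← ht] using this

theorem IsEquational.and {P Q : (V → Lat F d) → Prop} (hP : IsEquational P)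
    (hQ : IsEquational Q) : IsEquational fun u => P u ∧ Q u := by
  obtain ⟨t, ht⟩ := hP
  obtain ⟨s, hs⟩ := hQ
  exact ⟨.join t s, fun u => by simp only [LatTerm.eval, sup_eq_bot_iff, ht, hs]⟩

theorem IsEquational.imp (p : Prop) {P : (V → Lat F d) → Prop} (hP : IsEquational P) :
    IsEquational fun u => p → P u := by
  by_cases hp : p
  · simpa [hp] using hP
  · exact ⟨.zero, fun u => by simp [hp, LatTerm.eval]⟩

theorem IsTermFun.eq (h : Anisotropic F d) {f g : (V → Lat F d) → Lat F d} (hf : IsTermFun f)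
    (hg : IsTermFun g) : IsEquational fun u => f u = g u := by
  simpa only [le_antisymm_iff] using (hf.le h hg).and (hg.le h hf)

end TermFunctions

/-! ### Frames, bases and the coordinate map -/

section Frames

variable {F : Type*} [Field F] {d : ℕ}

theorem linComb_three_inj (v : Module.Basis (Fin d) F (Fin d → F)) {i j k : Fin d} (hij : i ≠ j)
    (hik : i ≠ k) (hjk : j ≠ k) {a b c a' b' c' : F}
    (h : a • v i + b • v j + c • v k = a' • v i + b' • v j + c' • v k) :
    a = a' ∧ b = b' ∧ c = c' := by
  have h1 := congrArg (v.coord i) h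
  have h2 := congrArg (v.coord j) h
  have h3 := congrArg (v.coord k) h
  simp [hij, hik, hjk, hij.symm, hik.symm, hjk.symm] at h1 h2 h3
  exact ⟨h1, h2, h3⟩

theorem linComb_two_inj (v : Module.Basis (Fin d) F (Fin d → F)) {i j : Fin d} (hij : i ≠ j)
    {a b a' b' : F} (h : a • v i + b • v j = a' • v i + b' • v j) : a = a' ∧ b = b' := by
  have h1 := congrArg (v.coord i) h
  have h2 := congrArg (v.coord j) h
  simp [hij, hij.symm] at h1 h2
  exact ⟨h1, h2⟩

theorem mem_span_sup_span {x y z : Fin d → F} :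
    z ∈ Submodule.span F {x} ⊔ Submodule.span F {y} ↔ ∃ a b : F, a • x + b • y = z := by
  rw [← Submodule.span_union, Set.singleton_union, Submodule.mem_span_pair]

theorem frameOf_self (v : Module.Basis (Fin d) F (Fin d → F)) (i : Fin d) :
    frameOf v (i, i) = Submodule.span F {v i} := by simp [frameOf]

theorem frameOf_ne (v : Module.Basis (Fin d) F (Fin d → F)) {i j : Fin d} (h : i ≠ j) :
    frameOf v (i, j) = Submodule.span F {v j - v i} := by simp [frameOf, h]

/-- In the plane of `v i` and `v j`, the line of `a v i + b v j` is obtained by intersecting with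
the span of two vectors involving a third basis vector `v k`. -/
theorem plane_inf_sup (v : Module.Basis (Fin d) F (Fin d → F)) {i j k : Fin d} (hij : i ≠ j)
    (hik : i ≠ k) (hjk : j ≠ k) {p q w : Fin d → F} {a b c e f : F}
    (hp : p = a • v i + c • v k)
    (hq : q = b • v i + e • v j + f • v k)
    (hf : f ≠ 0) (hw : w = (f * a - c * b) • v i + (- (c * e)) • v j) :
    (Submodule.span F {v i} ⊔ Submodule.span F {v j}) ⊓
      (Submodule.span F {p} ⊔ Submodule.span F {q}) = Submodule.span F {w} := by
  apply le_antisymm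
  · rintro z ⟨hz1, hz2⟩
    obtain ⟨α, β, hz1⟩ := mem_span_sup_span.1 hz1
    obtain ⟨γ, δ, hz2⟩ := mem_span_sup_span.1 hz2
    have h : α • v i + β • v j + (0 : F) • v k
        = (γ * a + δ * b) • v i + (δ * e) • v j + (γ * c + δ * f) • v k := by
      rw [zero_smul, add_zero, hz1, ← hz2, hp, hq]
      module
    obtain ⟨h1, h2, h3⟩ := linComb_three_inj v hij hik hjk h
    rw [Submodule.mem_span_singleton]
    -- The coefficient of `v k` must vanish, which leaves one free parameter.
    have hδ : δ = -(γ / f) * c := by field_simp; linear_combination -h3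
    refine ⟨γ / f, ?_⟩
    rw [← hz1, h1, h2, hw, smul_add, smul_smul, smul_smul]
    congr 2
    · rw [hδ]; field_simp; ring
    · rw [hδ]; ring
  · rw [Submodule.span_singleton_le_iff_mem]
    refine ⟨mem_span_sup_span.2 ⟨_, _, hw.symm⟩, mem_span_sup_span.2 ⟨f, -c, ?_⟩⟩
    rw [hw, hp, hq]
    module

theorem span_singleton_neg (x : Fin d → F) : Submodule.span F {-x} = Submodule.span F {x} := by
  rw [← Set.neg_singleton, Submodule.span_neg]

theorem span_sub_comm (x y : Fin d → F) :
    Submodule.span F {x - y} = Submodule.span F {y - x} := by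
  rw [← neg_sub, span_singleton_neg]

theorem isFrame_frameOf (v : Module.Basis (Fin d) F (Fin d → F)) : IsFrame (frameOf v) where
  indep := by
    simp only [frameOf_self]
    exact v.linearIndependent.iSupIndep_span_singleton
  sup_eq := by
    simp only [frameOf_self]
    rw [← Submodule.span_range_eq_iSup, v.span_eq]
  symm i j h := by
    rw [frameOf_ne v h, frameOf_ne v h.symm, span_sub_comm]
  sup_axis i j h := by
    rw [frameOf_self, frameOf_self, frameOf_ne v h]
    refine le_antisymm ?_ ?_
    · refine sup_le le_sup_left ?_
      rw [Submodule.span_singleton_le_iff_mem, mem_span_sup_span]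
      exact ⟨1, 1, by module⟩
    · refine sup_le le_sup_left ?_
      rw [Submodule.span_singleton_le_iff_mem, mem_span_sup_span]
      exact ⟨-1, 1, by module⟩
  disj_axis i j h := by
    rw [frameOf_self, frameOf_ne v h, Submodule.eq_bot_iff]
    rintro z ⟨h1, h2⟩
    obtain ⟨a, rfl⟩ := Submodule.mem_span_singleton.1 h1
    obtain ⟨b, hb⟩ := Submodule.mem_span_singleton.1 h2
    have : (-b) • v i + b • v j = a • v i + (0 : F) • v j := by
      rw [zero_smul, add_zero, ← hb]; module
    obtain ⟨h3, h4⟩ := linComb_two_inj v h this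
    rw [← h3, h4, neg_zero, zero_smul]
  triangle i j k hij hik hjk := by
    rw [frameOf_self, frameOf_self, frameOf_ne v hij, frameOf_ne v hik, frameOf_ne v hjk]
    rw [span_sub_comm]
    -- Here `v j` is the vector to be eliminated.
    exact (plane_inf_sup v hik hij hjk.symm (p := v j - v i) (q := v k - v j) (a := -1) (c := 1)
      (b := 0) (e := 1) (f := -1) (by module) (by module) (by simp) (by module)).symm

/-- The axes give one scalar for each of `v i` and `v j`; the diagonal line of `v j - v i` forces
the two to agree. Hence `ω` depends on the frame alone. -/
theorem span_eq_of_frameOf_eq {v w : Module.Basis (Fin d) F (Fin d → F)}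
    (h : frameOf v = frameOf w) {i j : Fin d} (hij : i ≠ j) :
    ∃ c : F, c ≠ 0 ∧ w i = c • v i ∧ w j = c • v j := by
  have hi := congrFun h (i, i)
  have hj := congrFun h (j, j)
  have hh := congrFun h (i, j)
  rw [frameOf_self, frameOf_self] at hi hj
  rw [frameOf_ne v hij, frameOf_ne w hij] at hh
  obtain ⟨a, ha⟩ := Submodule.mem_span_singleton.1 (hi ▸ Submodule.mem_span_singleton_self (w i))
  obtain ⟨b, hb⟩ := Submodule.mem_span_singleton.1 (hj ▸ Submodule.mem_span_singleton_self (w j))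
  obtain ⟨c, hc⟩ := Submodule.mem_span_singleton.1
    (hh ▸ Submodule.mem_span_singleton_self (w j - w i))
  have h1 : (-c) • v i + c • v j = (-a) • v i + b • v j := by
    have : c • (v j - v i) = b • v j - a • v i := by rw [hc, ha, hb]
    linear_combination (norm := module) this
  obtain ⟨h2, h3⟩ := linComb_two_inj v hij h1
  have hca : c = a := neg_injective h2
  refine ⟨c, ?_, by rw [hca, ha], by rw [h3, hb]⟩
  rintro rfl
  rw [← hca, zero_smul] at ha
  exact w.ne_zero i ha.symm

theorem idx_ne (hd : 3 ≤ d) : idx1 hd ≠ idx2 hd := by simp [idx1, idx2]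

theorem omega21_eq_of_frameOf_eq (hd : 3 ≤ d) {v w : Module.Basis (Fin d) F (Fin d → F)}
    (h : frameOf v = frameOf w) (r : F) : omega21 hd v r = omega21 hd w r := by
  obtain ⟨c, hc, h1, h2⟩ := span_eq_of_frameOf_eq h (idx_ne hd)
  rw [omega21, omega21, h1, h2, smul_comm r c, ← smul_sub,
    Submodule.span_singleton_smul_eq hc.isUnit]

theorem omega21_injective (hd : 3 ≤ d) (v : Module.Basis (Fin d) F (Fin d → F)) :
    Function.Injective (omega21 hd v) := by
  intro r s h
  rw [omega21, omega21] at h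
  obtain ⟨c, hc⟩ := Submodule.mem_span_singleton.1
    (h ▸ Submodule.mem_span_singleton_self (v (idx1 hd) - r • v (idx2 hd)))
  have : c • v (idx1 hd) + (-(c * s)) • v (idx2 hd)
      = (1 : F) • v (idx1 hd) + (-r) • v (idx2 hd) := by
    rw [one_smul, neg_smul r, ← sub_eq_add_neg, ← hc]; module
  obtain ⟨h1, h2⟩ := linComb_two_inj v (idx_ne hd) this
  rw [h1, one_mul] at h2
  exact (neg_injective h2).symm

theorem omega21_mem_R21 (hd : 3 ≤ d) (v : Module.Basis (Fin d) F (Fin d → F)) (r : F) :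
    omega21 hd v r ∈ R21 hd (frameOf v) := by
  constructor
  · rw [omega21, frameOf_self, frameOf_self]
    refine le_antisymm (sup_le ?_ le_sup_left) (sup_le le_sup_right ?_)
    · rw [Submodule.span_singleton_le_iff_mem, mem_span_sup_span]
      exact ⟨-r, 1, by module⟩
    · rw [Submodule.span_singleton_le_iff_mem, mem_span_sup_span]
      exact ⟨1, r, by module⟩
  · rw [omega21, frameOf_self, Submodule.eq_bot_iff]
    rintro z ⟨h1, h2⟩
    obtain ⟨a, rfl⟩ := Submodule.mem_span_singleton.1 h1
    obtain ⟨b, hb⟩ := Submodule.mem_span_singleton.1 h2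
    have : (0 : F) • v (idx1 hd) + b • v (idx2 hd)
        = a • v (idx1 hd) + (-(a * r)) • v (idx2 hd) := by
      rw [zero_smul, zero_add, hb]; module
    rw [← (linComb_two_inj v (idx_ne hd) this).1, zero_smul]

/-- The scalar is read off by writing `v 1` as an element of `u` plus a multiple `r • v 2`; the
trivial meet with `a_2` leaves no room for further vectors in `u`. -/
theorem exists_eq_omega21 (hd : 3 ≤ d) (v : Module.Basis (Fin d) F (Fin d → F)) {u : Lat F d}
    (hu : u ∈ R21 hd (frameOf v)) : ∃ r, u = omega21 hd v r := by
  obtain ⟨h1, h2⟩ := hu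
  rw [frameOf_self, frameOf_self] at h1
  rw [frameOf_self] at h2
  have hv1 : v (idx1 hd) ∈ u ⊔ Submodule.span F {v (idx2 hd)} := by
    rw [h1]
    exact Submodule.mem_sup_right (Submodule.mem_span_singleton_self _)
  obtain ⟨x, hx, y, hy, hxy⟩ := Submodule.mem_sup.1 hv1
  obtain ⟨r, rfl⟩ := Submodule.mem_span_singleton.1 hy
  have hx' : v (idx1 hd) - r • v (idx2 hd) = x := by rw [← hxy]; module
  refine ⟨r, le_antisymm (fun z hz => ?_) ?_⟩
  · have hz' : z ∈ Submodule.span F {v (idx2 hd)} ⊔ Submodule.span F {v (idx1 hd)} := by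
      rw [← h1]; exact Submodule.mem_sup_left hz
    obtain ⟨b, a, rfl⟩ := mem_span_sup_span.1 hz'
    have h3 : (b + a * r) • v (idx2 hd) ∈ u ⊓ Submodule.span F {v (idx2 hd)} := by
      refine ⟨?_, Submodule.smul_mem _ _ (Submodule.mem_span_singleton_self _)⟩
      have := u.sub_mem hz (u.smul_mem a hx)
      rw [← hx'] at this
      have h4 : (b + a * r) • v (idx2 hd) = b • v (idx2 hd) + a • v (idx1 hd)
          - a • (v (idx1 hd) - r • v (idx2 hd)) := by module
      rwa [h4]
    rw [h2, Submodule.mem_bot] at h3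
    rw [omega21, Submodule.mem_span_singleton]
    refine ⟨a, ?_⟩
    linear_combination (norm := module) -h3
  · rw [omega21, Submodule.span_singleton_le_iff_mem, hx']
    exact hx

theorem span_singleton_eq_of_finrank_eq_one {U : Submodule F (Fin d → F)}
    (h : Module.finrank F U = 1) {x : Fin d → F} (hx : x ∈ U) (h0 : x ≠ 0) :
    U = Submodule.span F {x} := by
  symm
  refine Submodule.eq_of_le_of_finrank_eq ((Submodule.span_singleton_le_iff_mem _ _).2 hx) ?_
  rw [h, finrank_span_singleton h0]

/-- All axes of a frame are one-dimensional, and so are the diagonals. -/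
theorem IsFrame.finrank_eq_one {a : Fin d × Fin d → Lat F d} (h : IsFrame a) (p : Fin d × Fin d) :
    Module.finrank F (a p) = 1 := by
  -- `a_j` and `a_ij` are both complements of `a_i` in the same subspace.
  have hax : ∀ i j, i ≠ j → Module.finrank F (a (j, j)) = Module.finrank F (a (i, j)) := by
    intro i j hij
    have h1 := Submodule.finrank_sup_add_finrank_inf_eq (a (i, i)) (a (j, j))
    have h2 := Submodule.finrank_sup_add_finrank_inf_eq (a (i, i)) (a (i, j))
    have h3 : a (i, i) ⊓ a (j, j) = ⊥ := disjoint_iff.1 (h.indep.pairwiseDisjoint hij)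
    rw [h.disj_axis i j hij, finrank_bot] at h2
    rw [h3, finrank_bot, h.sup_axis i j hij] at h1
    omega
  have heq : ∀ i j, Module.finrank F (a (i, i)) = Module.finrank F (a (j, j)) := by
    intro i j
    by_cases hij : i = j
    · rw [hij]
    · rw [hax i j hij, hax j i (Ne.symm hij), h.symm i j hij]
  have hint := DirectSum.isInternal_submodule_of_iSupIndep_of_iSup_eq_top h.indep h.sup_eq
  have hsum : ∑ i, Module.finrank F (a (i, i)) = d := by
    rw [← Module.finrank_directSum,
      (LinearEquiv.ofBijective (DirectSum.coeLinearMap fun i => a (i, i)) hint).finrank_eq,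
      Module.finrank_fin_fun]
  have hone : ∀ i, Module.finrank F (a (i, i)) = 1 := by
    intro i
    rw [Finset.sum_congr rfl fun j _ => heq j i] at hsum
    simp only [Finset.sum_const, Finset.card_univ, Fintype.card_fin, smul_eq_mul] at hsum
    have : 0 < d := i.pos
    exact Nat.eq_of_mul_eq_mul_left this (by rw [hsum, mul_one])
  obtain ⟨i, j⟩ := p
  by_cases hij : i = j
  · rw [hij, hone]
  · rw [← hax i j hij, hone]

/-- Fix a nonzero `x` on one axis `a_o`. Each other axis has a vector `w j` with `w j - x` on the
diagonal `a_oj`, since `x ∈ a_j + a_jo`. The triangle relation through `o` then places `w j - w i`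
on `a_ij`. -/
theorem IsFrame.exists_basis {a : Fin d × Fin d → Lat F d} (hd : 0 < d) (h : IsFrame a) :
    ∃ v : Module.Basis (Fin d) F (Fin d → F), a = frameOf v := by
  have hdim := h.finrank_eq_one
  let o : Fin d := ⟨0, hd⟩
  obtain ⟨⟨x, hx⟩, hx0, -⟩ := finrank_eq_one_iff'.1 (hdim (o, o))
  have hx0 : x ≠ 0 := fun h => hx0 (Subtype.ext h)
  have key : ∀ j, ∃ w ∈ a (j, j), w ≠ 0 ∧ (j = o → w = x) ∧
      (j ≠ o → w - x ∈ a (o, j) ∧ w - x ≠ 0) := by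
    intro j
    by_cases hj : j = o
    · subst hj; exact ⟨x, hx, hx0, fun _ => rfl, fun h => (h rfl).elim⟩
    · have hmem : x ∈ a (j, j) ⊔ a (j, o) := by
        rw [← h.sup_axis j o hj]; exact Submodule.mem_sup_right hx
      obtain ⟨w, hw, z, hz, hwz⟩ := Submodule.mem_sup.1 hmem
      rw [h.symm j o hj] at hz
      have hzx : w - x = -z := by rw [← hwz]; module
      refine ⟨w, hw, ?_, fun h => (hj h).elim, fun _ => ⟨?_, ?_⟩⟩
      · rintro rfl
        rw [zero_add] at hwz
        have : x ∈ a (o, o) ⊓ a (o, j) := ⟨hx, hwz ▸ hz⟩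
        rw [h.disj_axis o j (Ne.symm hj)] at this
        exact hx0 this
      · rw [hzx]; exact Submodule.neg_mem _ hz
      · intro h0
        have h1 : w = x := sub_eq_zero.1 h0
        have h2 := (h.indep.pairwiseDisjoint hj).le_bot ⟨hw, h1 ▸ hx⟩
        exact hx0 (h1 ▸ h2)
  choose w hw hw0 hwo hwd using key
  have hli : LinearIndependent F w := iSupIndep.linearIndependent _ h.indep hw hw0
  have : Nonempty (Fin d) := ⟨o⟩
  let v := basisOfLinearIndependentOfCardEqFinrank hli (by simp)
  have hv : ∀ i, v i = w i := fun i => by simp [v]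
  refine ⟨v, ?_⟩
  have hdiag : ∀ i, a (i, i) = Submodule.span F {w i} := fun i =>
    span_singleton_eq_of_finrank_eq_one (hdim _) (hw i) (hw0 i)
  have hne : ∀ i j, i ≠ j → w j - w i ≠ 0 := fun i j hij h0 =>
    hij (hli.injective (sub_eq_zero.1 h0)).symm
  have hmem : ∀ i j, i ≠ j → w j - w i ∈ a (i, j) := by
    have h1 : ∀ j, j ≠ o → w j - w o ∈ a (o, j) := fun j hj => by
      rw [hwo o rfl]; exact (hwd j hj).1
    have h2 : ∀ j, j ≠ o → w o - w j ∈ a (j, o) := fun j hj => by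
      rw [h.symm j o hj, ← neg_sub]; exact Submodule.neg_mem _ (h1 j hj)
    intro i j hij
    by_cases hi : i = o
    · subst hi; exact h1 j (Ne.symm hij)
    by_cases hj : j = o
    · subst hj; exact h2 i hi
    rw [h.triangle i o j hi hij (Ne.symm hj)]
    refine ⟨?_, ?_⟩
    · exact Submodule.sub_mem _ (Submodule.mem_sup_right (hw j)) (Submodule.mem_sup_left (hw i))
    · have : w j - w i = (w o - w i) + (w j - w o) := by module
      rw [this]
      exact Submodule.add_mem_sup (h2 i hi) (h1 j hj)
  funext ⟨i, j⟩
  by_cases hij : i = j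
  · subst hij; rw [frameOf_self, hv, hdiag]
  · rw [frameOf_ne v hij, hv, hv]
    exact span_singleton_eq_of_finrank_eq_one (hdim _) (hmem i j hij) (hne i j hij)

end Frames

/-! ### Equations for orthonormal frames and for the three conditions -/

section LatticeDefinability

variable {F : Type*} [Field F] {d : ℕ}

/-- The lattice expression which for the frame of `v` yields the line of `v i + v j`. -/
def sumLine (a : Fin d × Fin d → Lat F d) (i j k : Fin d) : Lat F d :=
  (a (i, i) ⊔ a (j, j)) ⊓ (a (k, k) ⊔ (a (i, i) ⊔ a (j, k)) ⊓ (a (j, j) ⊔ a (i, k)))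

/-- The inner meet is the line of `v k - v i - v j`; projecting it from `v k` into the plane of `v
i` and `v j` removes the `v k` component. -/
theorem sumLine_frameOf (v : Module.Basis (Fin d) F (Fin d → F)) {i j k : Fin d} (hij : i ≠ j)
    (hik : i ≠ k) (hjk : j ≠ k) :
    sumLine (frameOf v) i j k = Submodule.span F {v i + v j} := by
  have hinner : (Submodule.span F {v i} ⊔ Submodule.span F {v k - v j}) ⊓
      (Submodule.span F {v j} ⊔ Submodule.span F {v k - v i})
        = Submodule.span F {v k - v i - v j} := by
    apply le_antisymm
    · rintro z ⟨hz1, hz2⟩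
      obtain ⟨α, β, hz1⟩ := mem_span_sup_span.1 hz1
      obtain ⟨γ, δ, hz2⟩ := mem_span_sup_span.1 hz2
      have h : α • v i + (-β) • v j + β • v k = (-δ) • v i + γ • v j + δ • v k := by
        linear_combination (norm := module) hz1 - hz2
      obtain ⟨h1, -, h3⟩ := linComb_three_inj v hij hik hjk h
      rw [Submodule.mem_span_singleton]
      refine ⟨β, ?_⟩
      rw [← hz1, h1, ← h3]
      module
    · rw [Submodule.span_singleton_le_iff_mem]
      exact ⟨mem_span_sup_span.2 ⟨-1, 1, by module⟩, mem_span_sup_span.2 ⟨-1, 1, by module⟩⟩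
  rw [sumLine, frameOf_self, frameOf_self, frameOf_self, frameOf_ne v hjk, frameOf_ne v hik,
    hinner]
  exact plane_inf_sup v hij hik hjk (a := 0) (c := 1) (b := -1) (e := -1) (f := 1) (by module)
    (by module) one_ne_zero (by module)

/-- The third index. -/
def idx3 (hd : 3 ≤ d) : Fin d := ⟨2, by omega⟩

theorem idx1_ne_idx3 (hd : 3 ≤ d) : idx1 hd ≠ idx3 hd := by simp [idx1, idx3]

theorem idx2_ne_idx3 (hd : 3 ≤ d) : idx2 hd ≠ idx3 hd := by simp [idx2, idx3]

/-- The lattice expression which for the frame of `v` sends the line of `v 1 - s v 2` to the line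
of `s v 1 + v 2`. -/
def skewLine (hd : 3 ≤ d) (a : Fin d × Fin d → Lat F d) (u : Lat F d) : Lat F d :=
  (a (idx1 hd, idx1 hd) ⊔ a (idx2 hd, idx2 hd)) ⊓
    ((a (idx3 hd, idx3 hd) ⊔ a (idx1 hd, idx1 hd)) ⊓
      ((a (idx2 hd, idx2 hd) ⊔ a (idx3 hd, idx3 hd)) ⊓ (u ⊔ a (idx1 hd, idx3 hd)) ⊔
        a (idx1 hd, idx2 hd)) ⊔
      sumLine a (idx2 hd) (idx3 hd) (idx1 hd))

/-- Three perspectivities, with centres `v 3 - v 1`, `v 2 - v 1` and `v 2 + v 3`, carry `v 1 - s v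
2` to `s v 2 - v 3`, then to `s v 1 - v 3`, then to `s v 1 + v 2`. -/
theorem skewLine_frameOf (hd : 3 ≤ d) (v : Module.Basis (Fin d) F (Fin d → F)) (s : F) :
    skewLine hd (frameOf v) (omega21 hd v s)
      = Submodule.span F {s • v (idx1 hd) + v (idx2 hd)} := by
  have h12 := idx_ne hd
  have h13 := idx1_ne_idx3 hd
  have h23 := idx2_ne_idx3 hd
  rw [skewLine, sumLine_frameOf v h23 h12.symm h13.symm, frameOf_self, frameOf_self, frameOf_self,
    frameOf_ne v h12, frameOf_ne v h13, omega21]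
  rw [plane_inf_sup v h23 h12.symm h13.symm (a := -s) (c := 1) (b := 0) (e := 1) (f := -1)
    (w := s • v (idx2 hd) - v (idx3 hd)) (by module) (by module) (by simp) (by module)]
  rw [plane_inf_sup v h13.symm h23.symm h12 (a := -1) (c := s) (b := 0) (e := -1) (f := 1)
    (w := s • v (idx1 hd) - v (idx3 hd)) (by module) (by module) (by simp) (by module)]
  exact plane_inf_sup v h12 h13 h23 (a := s) (c := -1) (b := 0) (e := 1) (f := 1) (by module)
    (by module) one_ne_zero (by module)

theorem exists_third (hd : 3 ≤ d) (i j : Fin d) : ∃ k, i ≠ k ∧ j ≠ k := by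
  have : ({i, j} : Finset (Fin d)).card < Fintype.card (Fin d) := by
    rw [Fintype.card_fin]
    exact Finset.card_le_two.trans_lt hd
  obtain ⟨k, -, hk⟩ := Finset.exists_mem_notMem_of_card_lt_card
    (show ({i, j} : Finset (Fin d)).card < (Finset.univ : Finset (Fin d)).card from this)
  simp only [Finset.mem_insert, Finset.mem_singleton, not_or] at hk
  exact ⟨k, Ne.symm hk.1, Ne.symm hk.2⟩

theorem omega21_inf_eq_bot_iff (hd : 3 ≤ d) (v : Module.Basis (Fin d) F (Fin d → F)) (r : F) :
    omega21 hd v r ⊓ frameOf v (idx1 hd, idx1 hd) = ⊥ ↔ r ≠ 0 := by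
  rw [frameOf_self, omega21]
  constructor
  · rintro h rfl
    rw [zero_smul, sub_zero, inf_idem, Submodule.span_singleton_eq_bot] at h
    exact v.ne_zero _ h
  · intro hr
    rw [Submodule.eq_bot_iff]
    rintro z ⟨h1, h2⟩
    obtain ⟨a, rfl⟩ := Submodule.mem_span_singleton.1 h1
    obtain ⟨b, hb⟩ := Submodule.mem_span_singleton.1 h2
    have h3 : b • v (idx1 hd) + (0 : F) • v (idx2 hd)
        = a • v (idx1 hd) + (-(a * r)) • v (idx2 hd) := by
      linear_combination (norm := module) hb
    have h4 := (linComb_two_inj v (idx_ne hd) h3).2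
    have : a = 0 := by simpa [hr] using h4.symm
    rw [this, zero_smul]

variable [StarRing F]

theorem iSupIndep_of_le_perp (h : Anisotropic F d) {ι : Type*} {p : ι → Lat F d}
    (hp : ∀ i j, i ≠ j → p i ≤ perp (p j)) : iSupIndep p := by
  intro i
  have : ⨆ j, ⨆ _ : j ≠ i, p j ≤ perp (p i) := iSup_le fun j => iSup_le fun hj => hp j i hj
  exact (disjoint_iff.2 (h.inf_perp _)).mono_right this

/-- Each clause on the right is equational: orthogonality of the axes supersedes independence, and
the last clause encodes equal norms, as `⟨v j - v i | v i + v j⟩ = ⟨v j | v j⟩ - ⟨v i | v i⟩` for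
orthogonal `v i`, `v j`. -/
theorem isAlphaFrame_iff (h : Anisotropic F d) (hd : 3 ≤ d) (a : Fin d × Fin d → Lat F d) :
    IsAlphaFrame a ↔
      (∀ i j, i ≠ j → a (i, i) ≤ perp (a (j, j))) ∧ (⨆ i, a (i, i) = ⊤) ∧
      (∀ i j, i ≠ j → a (i, j) = a (j, i)) ∧
      (∀ i j, i ≠ j → a (i, i) ⊔ a (j, j) = a (i, i) ⊔ a (i, j)) ∧
      (∀ i j, i ≠ j → a (i, i) ⊓ a (i, j) = ⊥) ∧
      (∀ i j k, i ≠ j → i ≠ k → j ≠ k →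
        a (i, k) = (a (i, i) ⊔ a (k, k)) ⊓ (a (i, j) ⊔ a (j, k))) ∧
      ∀ i j k, i ≠ j → i ≠ k → j ≠ k → a (i, j) ≤ perp (sumLine a i j k) := by
  have hform : ∀ (v : Module.Basis (Fin d) F (Fin d → F)) (i j : Fin d),
      form (v i) (v j) = 0 → form (v j) (v i) = 0 →
        form (v j - v i) (v i + v j) = form (v j) (v j) - form (v i) (v i) := by
    intro v i j h1 h2
    rw [form_sub_left, form_add_right, form_add_right, h1, h2]
    ring
  constructor
  · rintro ⟨hf, v, ⟨ho, hn⟩, rfl⟩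
    refine ⟨fun i j hij => ?_, hf.sup_eq, hf.symm, hf.sup_axis, hf.disj_axis, hf.triangle,
      fun i j k hij hik hjk => ?_⟩
    · rw [frameOf_self, frameOf_self, span_singleton_le_perp_span_singleton, ho i j hij]
    · rw [sumLine_frameOf v hij hik hjk, frameOf_ne v hij, span_singleton_le_perp_span_singleton,
        hform v i j (ho i j hij) (ho j i hij.symm), hn j i, sub_self]
  · rintro ⟨ho, htop, hsymm, hsup, hdisj, htri, hn⟩
    have hf : IsFrame a := ⟨iSupIndep_of_le_perp h ho, htop, hsymm, hsup, hdisj, htri⟩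
    obtain ⟨v, rfl⟩ := hf.exists_basis (by omega)
    have ho' : ∀ i j, i ≠ j → form (v i) (v j) = 0 := fun i j hij => by
      have := ho i j hij
      rwa [frameOf_self, frameOf_self, span_singleton_le_perp_span_singleton] at this
    refine ⟨hf, v, ⟨ho', fun i j => ?_⟩, rfl⟩
    by_cases hij : i = j
    · rw [hij]
    obtain ⟨k, hik, hjk⟩ := exists_third hd i j
    have := hn i j k hij hik hjk
    rw [sumLine_frameOf v hij hik hjk, frameOf_ne v hij, span_singleton_le_perp_span_singleton,
      hform v i j (ho' i j hij) (ho' j i (Ne.symm hij))] at this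
    exact (sub_eq_zero.1 this).symm

variable {V : Type}

theorem IsTermFun.sumLine (h : Anisotropic F d) {a : Fin d × Fin d → (V → Lat F d) → Lat F d}
    (ha : ∀ p, IsTermFun (a p)) (i j k : Fin d) :
    IsTermFun fun u => FrameDef.sumLine (fun p => a p u) i j k :=
  ((ha _).sup (ha _)).inf h ((ha _).sup (((ha _).sup (ha _)).inf h ((ha _).sup (ha _))))

theorem IsTermFun.skewLine (h : Anisotropic F d) (hd : 3 ≤ d)
    {a : Fin d × Fin d → (V → Lat F d) → Lat F d} (ha : ∀ p, IsTermFun (a p))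
    {f : (V → Lat F d) → Lat F d} (hf : IsTermFun f) :
    IsTermFun fun u => FrameDef.skewLine hd (fun p => a p u) (f u) :=
  ((ha _).sup (ha _)).inf h
    ((((ha _).sup (ha _)).inf h ((((ha _).sup (ha _)).inf h (hf.sup (ha _))).sup (ha _))).sup
      (IsTermFun.sumLine h ha _ _ _))

theorem isEquational_isAlphaFrame (h : Anisotropic F d) (hd : 3 ≤ d)
    {a : Fin d × Fin d → (V → Lat F d) → Lat F d} (ha : ∀ p, IsTermFun (a p)) :
    IsEquational fun u => IsAlphaFrame fun p => a p u := by
  simp only [isAlphaFrame_iff h hd]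
  refine .and (.forall fun i => .forall fun j => .imp _ <| (ha _).le h (ha _).perp) <|
    .and ((IsTermFun.iSup fun i => ha (i, i)).eq h (.top h)) <|
    .and (.forall fun i => .forall fun j => .imp _ <| (ha _).eq h (ha _)) <|
    .and (.forall fun i => .forall fun j => .imp _ <| ((ha _).sup (ha _)).eq h ((ha _).sup (ha _)))
    <| .and (.forall fun i => .forall fun j => .imp _ <| ((ha _).inf h (ha _)).eq_bot) <|
    .and (.forall fun i => .forall fun j => .forall fun k => .imp _ <| .imp _ <| .imp _ <|
      (ha _).eq h (((ha _).sup (ha _)).inf h ((ha _).sup (ha _)))) <|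
    .forall fun i => .forall fun j => .forall fun k => .imp _ <| .imp _ <| .imp _ <|
      (ha _).le h (IsTermFun.sumLine h ha _ _ _).perp

/-- `M_φ` is defined by an equation if `φ` is expressed by an equation within every orthonormal
frame. -/
theorem definedByEquation_MSet (h : Anisotropic F d) (hd : 3 ≤ d) {n : ℕ}
    {φ : (Fin n → F) → Prop} {Φ : ((Fin d × Fin d) ⊕ Fin n → Lat F d) → Prop}
    (hΦ : IsEquational Φ)
    (hφ : ∀ (v : Module.Basis (Fin d) F (Fin d → F)) (r : Fin n → F), IsAlphaBasis v →
      (Φ (Sum.elim (frameOf v) fun k => omega21 hd v (r k)) ↔ φ r)) :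
    DefinedByEquation (MSet hd φ) := by
  have hvar : ∀ w, IsTermFun fun u : (Fin d × Fin d) ⊕ Fin n → Lat F d => u w := .var
  have hE : IsEquational fun u : (Fin d × Fin d) ⊕ Fin n → Lat F d =>
      (IsAlphaFrame fun p => u (Sum.inl p)) ∧
        (∀ k, u (Sum.inr k) ∈ R21 hd fun p => u (Sum.inl p)) ∧ Φ u := by
    refine .and (isEquational_isAlphaFrame h hd fun p => hvar (Sum.inl p)) <|
      .and (.forall fun k => ?_) hΦ
    simp only [R21, Set.mem_ofPred_eq]
    exact .and (((hvar _).sup (hvar _)).eq h ((hvar _).sup (hvar _)))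
      ((hvar _).inf h (hvar _)).eq_bot
  obtain ⟨t, ht⟩ := hE
  refine ⟨t, Set.ext fun u => ?_⟩
  rw [Set.mem_ofPred_eq, ← ht]
  refine and_congr_right fun ha => and_congr_right fun hR => ?_
  obtain ⟨-, v, hv, hav⟩ := ha
  rw [hav] at hR
  choose r hr using fun k => exists_eq_omega21 hd v (hR k)
  have hu : u = Sum.elim (frameOf v) fun k => omega21 hd v (r k) := by
    funext w
    cases w with
    | inl p => exact congrFun hav p
    | inr k => exact hr k
  rw [hav]
  nth_rewrite 2 [hu]
  rw [hφ v r hv]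
  constructor
  -- The witnessing basis may differ from `v`, but it has the same frame and so the same
  -- coordinates.
  · rintro ⟨w, hw, s, hs, hsu⟩
    have : s = r := funext fun k => omega21_injective hd v <| by
      rw [← hr k, hsu k, omega21_eq_of_frameOf_eq hd hw]
    rwa [← this]
  · exact fun hr' => ⟨v, rfl, r, hr', hr⟩

theorem definedByEquation_ne_zero (h : Anisotropic F d) (hd : 3 ≤ d) :
    DefinedByEquation (MSet (F := F) hd fun x : Fin 1 → F => x 0 ≠ 0) :=
  definedByEquation_MSet h hd
    (((IsTermFun.var (Sum.inr 0)).inf h (.var (Sum.inl (idx1 hd, idx1 hd)))).eq_bot)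
    fun v r _ => omega21_inf_eq_bot_iff hd v (r 0)

/-- The meet of `ω(s)` with `a_1` is `a_1` or `0` according to whether `s = 0`, so the equivalence
is equality of two meets. -/
theorem definedByEquation_zero_iff_zero (h : Anisotropic F d) (hd : 3 ≤ d) :
    DefinedByEquation (MSet (F := F) hd fun x : Fin 2 → F => (x 0 = 0 ↔ x 1 = 0)) := by
  refine definedByEquation_MSet h hd
    (((IsTermFun.var (Sum.inr 0)).inf h (.var (Sum.inl (idx1 hd, idx1 hd)))).eq h
      ((IsTermFun.var (Sum.inr 1)).inf h (.var (Sum.inl (idx1 hd, idx1 hd))))) fun v r _ => ?_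
  classical
  have key : ∀ s, omega21 hd v s ⊓ frameOf v (idx1 hd, idx1 hd)
      = if s = 0 then frameOf v (idx1 hd, idx1 hd) else ⊥ := by
    intro s
    split_ifs with hs
    · rw [hs, omega21, frameOf_self, zero_smul, sub_zero, inf_idem]
    · exact (omega21_inf_eq_bot_iff hd v s).2 hs
  have hne : frameOf v (idx1 hd, idx1 hd) ≠ ⊥ := by
    rw [frameOf_self, Ne, Submodule.span_singleton_eq_bot]
    exact v.ne_zero _
  simp only [Sum.elim_inr, Sum.elim_inl, key]
  by_cases h0 : r 0 = 0 <;> by_cases h1 : r 1 = 0 <;> simp [h0, h1, hne, hne.symm]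

/-- `⟨s v 1 + v 2 | v 1 - r v 2⟩ = (s^* - r) ⟨v 1 | v 1⟩`, and the norm is nonzero by anisotropy. -/
theorem definedByEquation_star (h : Anisotropic F d) (hd : 3 ≤ d) :
    DefinedByEquation (MSet (F := F) hd fun x : Fin 2 → F => x 1 = star (x 0)) := by
  refine definedByEquation_MSet h hd
    ((IsTermFun.skewLine h hd (fun p => .var (Sum.inl p)) (.var (Sum.inr 1))).le h
      (IsTermFun.var (Sum.inr 0)).perp) fun v r hv => ?_
  have h12 := hv.1 _ _ (idx_ne hd)
  have h21 := hv.1 _ _ (idx_ne hd).symm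
  have hn : form (v (idx1 hd)) (v (idx1 hd)) ≠ 0 := fun h0 => v.ne_zero _ (h _ h0)
  change skewLine hd (frameOf v) (omega21 hd v (r 1)) ≤ perp (omega21 hd v (r 0)) ↔ _
  rw [skewLine_frameOf, omega21, span_singleton_le_perp_span_singleton, form_add_left,
    form_sub_right, form_sub_right, form_smul_left, form_smul_left, form_smul_right,
    form_smul_right, h12, h21, hv.2 (idx2 hd) (idx1 hd)]
  have : star (r 1) * form (v (idx1 hd)) (v (idx1 hd)) - star (r 1) * (r 0 * 0) +
      (0 - r 0 * form (v (idx1 hd)) (v (idx1 hd)))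
        = (star (r 1) - r 0) * form (v (idx1 hd)) (v (idx1 hd)) := by ring
  rw [this, mul_eq_zero, or_iff_left hn, sub_eq_zero, star_eq_iff_star_eq, eq_comm]

end LatticeDefinability

/-! ### Coordinate vectors over the standard frame -/

section TestPoints

variable {F : Type*} [Field F] {d : ℕ}

theorem isPlueckerOf_one_span (w : Fin d → F) (hw : w ≠ 0) :
    IsPlueckerOf 1 (Submodule.span F {w}) fun i => w (i 0) := by
  obtain ⟨j, hj⟩ := Function.ne_iff.1 hw
  -- All columns equal `w`; the `1 × 1` minors are then its entries.
  let A : Matrix (Fin d) (Fin d) F := Matrix.of fun i _ => w i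
  have hspan : Submodule.span F (Set.range fun j i => A i j) = Submodule.span F {w} := by
    have : Nonempty (Fin d) := ⟨j⟩
    exact congrArg _ (Set.range_const (c := w))
  refine ⟨A, ?_, hspan, ?_⟩
  · rw [Matrix.rank_eq_finrank_span_cols]
    exact (congrArg (fun U : Submodule F (Fin d → F) => Module.finrank F U) hspan).trans
      (finrank_span_singleton hw)
  · let c : Fin 1 ↪o Fin d := OrderEmbedding.ofStrictMono (fun _ => j) (Subsingleton.strictMono _)
    rw [plueckerSet, if_neg one_ne_zero]
    refine ⟨Submodule.subset_span ⟨c, funext fun i => ?_⟩, fun h => hj ?_⟩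
    · simp [minors, A, Matrix.det_unique]
    · exact congrFun h c

theorem IsPlueckerOf.grass {k : ℕ} {U : Submodule F (Fin d → F)} {r : (Fin k ↪o Fin d) → F}
    (h : IsPlueckerOf k U r) : r ∈ Grass F d k := by
  obtain ⟨A, h1, -, h2⟩ := h
  exact ⟨A, h1, h2⟩

theorem IsPlueckerOf.finrank_eq {k : ℕ} {U : Submodule F (Fin d → F)} {r : (Fin k ↪o Fin d) → F}
    (h : IsPlueckerOf k U r) : Module.finrank F U = k := by
  obtain ⟨A, h1, h2, -⟩ := h
  rw [← h1, Matrix.rank_eq_finrank_span_cols, ← h2]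
  rfl

theorem IsPlueckerOf.eq_span_of_one {U : Submodule F (Fin d → F)} {w : Fin d → F}
    (h : IsPlueckerOf 1 U fun i => w (i 0)) : U = Submodule.span F {w} := by
  have hU := h.finrank_eq
  obtain ⟨A, h1, rfl, h2⟩ := h
  rw [plueckerSet, if_neg one_ne_zero] at h2
  obtain ⟨h2, h3⟩ := h2
  have hw : w ≠ 0 := by
    rintro rfl
    exact h3 rfl
  refine span_singleton_eq_of_finrank_eq_one hU ?_ hw
  -- Reindexing along the identification of `1`-tuples with indices turns minors into columns.
  let L : ((Fin 1 ↪o Fin d) → F) →ₗ[F] (Fin d → F) := LinearMap.pi fun j =>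
    LinearMap.proj (OrderEmbedding.ofStrictMono (fun _ => j) (Subsingleton.strictMono _))
  have h4 : Submodule.span F (Set.range (minors 1 A))
      ≤ (Submodule.span F (Set.range fun j i => A i j)).comap L := by
    rw [Submodule.span_le]
    rintro _ ⟨c, rfl⟩
    refine Submodule.subset_span ⟨c 0, funext fun i => ?_⟩
    simp [L, minors, Matrix.det_unique]
  exact h4 h2

/-- The sort of the coordinate vectors of points. -/
def pointIdx (hd : 3 ≤ d) : Fin (d + 1) := ⟨1, by omega⟩

/-- Vectors spanning the members of the standard frame and the elements `ω(r k)`. -/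
def testVec (hd : 3 ≤ d) {n : ℕ} (r : Fin n → F) : (Fin d × Fin d) ⊕ Fin n → Fin d → F
  | .inl p => if p.1 = p.2 then Pi.single p.1 1 else Pi.single p.2 1 - Pi.single p.1 1
  | .inr k => Pi.single (idx1 hd) 1 - r k • Pi.single (idx2 hd) 1

theorem testVec_ne_zero (hd : 3 ≤ d) {n : ℕ} (r : Fin n → F) (v : (Fin d × Fin d) ⊕ Fin n) :
    testVec hd r v ≠ 0 := by
  intro h
  rcases v with ⟨i, j⟩ | k
  · by_cases hij : i = j
    · simpa [testVec, hij] using congrFun h i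
    · simpa [testVec, hij] using congrFun h i
  · simpa [testVec, idx_ne hd] using congrFun h (idx1 hd)

theorem span_testVec_inl (hd : 3 ≤ d) {n : ℕ} (r : Fin n → F) (p : Fin d × Fin d) :
    Submodule.span F {testVec hd r (.inl p)} = frameOf (Pi.basisFun F (Fin d)) p := by
  simp only [frameOf, testVec, Pi.basisFun_apply]
  split_ifs <;> rfl

theorem span_testVec_inr (hd : 3 ≤ d) {n : ℕ} (r : Fin n → F) (k : Fin n) :
    Submodule.span F {testVec hd r (.inr k)} = omega21 hd (Pi.basisFun F (Fin d)) (r k) := by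
  simp only [omega21, testVec, Pi.basisFun_apply]

/-- Coordinate vectors for the standard frame and the elements `ω(r k)`. -/
def testPoint (hd : 3 ≤ d) {n : ℕ} (r : Fin n → F) (v : (Fin d × Fin d) ⊕ Fin n) :
    (Srt.gr (pointIdx hd)).Dom F :=
  ⟨fun i : Fin 1 ↪o Fin d => testVec hd r v (i 0),
    (isPlueckerOf_one_span _ (testVec_ne_zero hd r v)).grass⟩

variable [StarRing F]

theorem isAlphaBasis_basisFun : IsAlphaBasis (Pi.basisFun F (Fin d)) := by
  have : ∀ i j : Fin d, form (Pi.basisFun F (Fin d) i) (Pi.basisFun F (Fin d) j)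
      = if i = j then 1 else 0 := by
    intro i j
    by_cases h : i = j
    · subst h; simp [form, Pi.single_apply]
    · simp [form, Pi.single_apply, h, Ne.symm h]
  exact ⟨fun i j hij => by rw [this, if_neg hij], fun i j => by rw [this, this]; simp⟩

/-- Coordinate vectors determine their subspaces, these determine the frame, and the frame
determines `r` through the injective `ω`. -/
theorem testPoint_mem_theta_iff (hd : 3 ≤ d) {n : ℕ} (φ : (Fin n → F) → Prop) (r : Fin n → F) :
    (⟨fun _ => pointIdx hd, testPoint hd r⟩ : Σ δ : (Fin d × Fin d) ⊕ Fin n → Fin (d + 1),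
      ∀ v, (Srt.gr (δ v)).Dom F) ∈ theta (MSet hd φ) ↔ φ r := by
  constructor
  · rintro ⟨u, ⟨-, -, v, hv, s, hs, hu⟩, h⟩
    have h' : ∀ w, u w = Submodule.span F {testVec hd r w} := fun w =>
      IsPlueckerOf.eq_span_of_one (h w)
    have hf : frameOf v = frameOf (Pi.basisFun F (Fin d)) := by
      rw [← hv]
      exact funext fun p => (h' _).trans (span_testVec_inl hd r p)
    have : s = r := funext fun k => omega21_injective hd v <| by
      rw [← hu k, h', span_testVec_inr, omega21_eq_of_frameOf_eq hd hf]
    rwa [← this]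
  · intro hr
    have hf : (fun p => Submodule.span F {testVec hd r (.inl p)})
        = frameOf (Pi.basisFun F (Fin d)) := funext fun p => span_testVec_inl hd r p
    refine ⟨fun w => Submodule.span F {testVec hd r w}, ⟨?_, fun k => ?_, ?_⟩, fun w =>
      isPlueckerOf_one_span _ (testVec_ne_zero hd r w)⟩
    · simp only [hf]
      exact ⟨isFrame_frameOf _, _, isAlphaBasis_basisFun, rfl⟩
    · simp only [hf, span_testVec_inr]
      exact omega21_mem_R21 hd _ _
    · exact ⟨_, hf, r, hr, fun k => span_testVec_inr hd r k⟩

/-- A formula describes tuples of one dimension vector only, so a single test point in the set fixes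
it. -/
theorem Fml.Defines.sort_eq {hd : 3 ≤ d} {n : ℕ} {φ : (Fin n → F) → Prop}
    {δ : (Fin d × Fin d) ⊕ Fin n → Fin (d + 1)} {ψ : Fml d _ fun v => Srt.gr (δ v)}
    (h : ψ.Defines (theta (MSet hd φ))) {r : Fin n → F} (hr : φ r) :
    δ = fun _ => pointIdx hd := by
  have := (testPoint_mem_theta_iff hd φ r).2 hr
  rw [h] at this
  obtain ⟨x, -, hx⟩ := this
  exact congrArg Sigma.fst hx

theorem Fml.Defines.holds_testPoint_iff {hd : 3 ≤ d} {n : ℕ} {φ : (Fin n → F) → Prop}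
    {ψ : Fml d ((Fin d × Fin d) ⊕ Fin n) fun _ => Srt.gr (pointIdx hd)}
    (h : ψ.Defines (δ := fun _ => pointIdx hd) (theta (MSet hd φ))) (r : Fin n → F) :
    ψ.Holds (testPoint hd r) ↔ φ r := by
  rw [← testPoint_mem_theta_iff hd φ r, h]
  constructor
  · exact fun hr => ⟨_, hr, rfl⟩
  · rintro ⟨x, hx, hxr⟩
    have := eq_of_heq (Sigma.mk.inj hxr).2
    rwa [← this]

end TestPoints

/-! ### Equations and negated equations along lines of naturals -/

section Polynomials

variable {F : Type*} [Field F] [StarRing F] {d : ℕ} {V : Type} {s : V → Srt d}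

/-- Sequences of assignments on an affine line, at the points with natural parameter. -/
def IsAffineSeq (x : ℕ → ∀ v, (s v).Dom F) : Prop :=
  ∃ a b : (Σ v, (s v).Coord) → F, ∀ n c, (x n c.1).1 c.2 = a c + n * b c

/-- Since `star n = n`, the conjugate of `a + n b` is `a^* + n b^*`, again affine in `n`. -/
theorem StarPoly.exists_polynomial {x : ℕ → ∀ v, (s v).Dom F} (hx : IsAffineSeq x)
    (p : StarPoly (Σ v, (s v).Coord)) :
    ∃ P : Polynomial F, ∀ n : ℕ, p.value (fun c => (x n c.1).1 c.2) = P.eval (n : F) := by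
  obtain ⟨a, b, hab⟩ := hx
  refine ⟨MvPolynomial.eval₂ (Int.castRingHom _)
    (Sum.elim (fun c => Polynomial.C (a c) + Polynomial.X * Polynomial.C (b c))
      fun c => Polynomial.C (star (a c)) + Polynomial.X * Polynomial.C (star (b c))) p,
    fun n => ?_⟩
  rw [← Polynomial.coe_evalRingHom, MvPolynomial.hom_eval₂, StarPoly.value]
  congr 1
  · exact RingHom.ext_int _ _
  · funext c
    cases c <;> simp [hab] <;> exact mul_comm _ _

variable [CharZero F]

omit [StarRing F] in
theorem polynomial_eq_zero_of_infinite_nat {P : Polynomial F}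
    (h : {n : ℕ | P.eval (n : F) = 0}.Infinite) : P = 0 := by
  refine Polynomial.eq_zero_of_infinite_isRoot P ?_
  refine (h.image (Nat.cast_injective (R := F)).injOn).mono ?_
  rintro _ ⟨n, hn, rfl⟩
  exact hn

theorem StarPoly.value_eq_zero_of_infinite {x : ℕ → ∀ v, (s v).Dom F} (hx : IsAffineSeq x)
    (p : StarPoly (Σ v, (s v).Coord))
    (h : {n : ℕ | p.value (fun c => (x n c.1).1 c.2) = 0}.Infinite) (n : ℕ) :
    p.value (fun c => (x n c.1).1 c.2) = 0 := by
  obtain ⟨P, hP⟩ := p.exists_polynomial hx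
  simp only [hP] at h ⊢
  rw [polynomial_eq_zero_of_infinite_nat h, Polynomial.eval_zero]

/-- Positive quantifier free formulas define closed sets. -/
theorem Fml.IsQFPositive.holds_of_infinite {ψ : Fml d V s} (hψ : ψ.IsQFPositive)
    {x : ℕ → ∀ v, (s v).Dom F} (hx : IsAffineSeq x) (h : {n : ℕ | ψ.Holds (x n)}.Infinite)
    (n : ℕ) : ψ.Holds (x n) := by
  induction ψ with
  | eqn p => exact p.value_eq_zero_of_infinite hx h n
  | neg => exact hψ.elim
  | all => exact hψ.elim
  | ex => exact hψ.elim
  | and ψ χ ih1 ih2 =>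
    exact ⟨ih1 hψ.1 hx (h.mono fun _ hn => hn.1), ih2 hψ.2 hx (h.mono fun _ hn => hn.2)⟩
  | or ψ χ ih1 ih2 =>
    have : ({n : ℕ | ψ.Holds (x n)} ∪ {n : ℕ | χ.Holds (x n)}).Infinite := h
    -- One of the two disjuncts holds infinitely often.
    rcases Set.infinite_union.1 this with h1 | h1
    · exact Or.inl (ih1 hψ.1 hx h1)
    · exact Or.inr (ih2 hψ.2 hx h1)

/-- If a conjunction of equations and negated equations holds in the origin and off the axes of an
integral grid, then it holds in almost all points of an axis. -/
theorem Fml.IsLiteralConj.finite_not_holds {ψ : Fml d V s} (hψ : ψ.IsLiteralConj)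
    {x : ℕ → ℕ → ∀ v, (s v).Dom F} (hx : IsAffineSeq fun n => x n 0)
    (hx' : ∀ n, IsAffineSeq (x n)) (h0 : ψ.Holds (x 0 0))
    (h : ∀ n m, n ≠ 0 → m ≠ 0 → ψ.Holds (x n m)) : {n : ℕ | ¬ ψ.Holds (x n 0)}.Finite := by
  induction ψ with
  | eqn p =>
    -- For `n ≠ 0` the equation holds at all `(n, m)` with `m ≠ 0`, hence also at `m = 0`.
    refine (Set.finite_singleton 0).subset fun n hn => ?_
    by_contra hn0
    refine hn (p.value_eq_zero_of_infinite (hx' n) ?_ 0)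
    exact (Set.finite_singleton 0).infinite_compl.mono fun m hm => h n m hn0 hm
  | neg ψ ih =>
    cases ψ with
    | eqn p =>
      -- Otherwise `p` vanishes infinitely often on the axis, hence at the origin too.
      by_contra hinf
      refine h0 (p.value_eq_zero_of_infinite hx (Set.Infinite.mono ?_ hinf) 0)
      exact fun n hn => not_not.1 hn
    | neg => exact hψ.elim
    | and => exact hψ.elim
    | or => exact hψ.elim
    | all => exact hψ.elim
    | ex => exact hψ.elim
  | all => exact hψ.elim
  | ex => exact hψ.elim
  | or => exact hψ.elim
  | and ψ χ ih1 ih2 =>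
    refine ((ih1 hψ.1 hx hx' h0.1 fun n m hn hm => (h n m hn hm).1).union
      (ih2 hψ.2 hx hx' h0.2 fun n m hn hm => (h n m hn hm).2)).subset fun n hn => ?_
    exact not_and_or.1 hn

omit [StarRing F] [CharZero F] in
theorem isAffineSeq_testPoint (hd : 3 ≤ d) {n : ℕ} {r : ℕ → Fin n → F} {a b : Fin n → F}
    (hr : ∀ m k, r m k = a k + m * b k) : IsAffineSeq fun m => testPoint hd (r m) := by
  refine ⟨fun c => testVec hd a c.1 ((show Fin 1 ↪o Fin d from c.2) 0), fun c => c.1.elim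
    (fun _ => 0) fun k => -(b k * (Pi.single (idx2 hd) 1 : Fin d → F)
      ((show Fin 1 ↪o Fin d from c.2) 0)), ?_⟩
  rintro m ⟨p | k, c⟩
  · simp [testPoint, testVec]
  · simp only [testPoint, testVec, hr, Pi.sub_apply, Pi.smul_apply, smul_eq_mul, Sum.elim_inr]
    ring

theorem not_defines_of_isQFPositive (hd : 3 ≤ d) :
    ¬ ∃ (δ : (Fin d × Fin d) ⊕ Fin 1 → Fin (d + 1)) (ψ : Fml d _ fun v => Srt.gr (δ v)),
      ψ.IsQFPositive ∧ ψ.Defines (theta (MSet (F := F) hd fun x : Fin 1 → F => x 0 ≠ 0)) := by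
  rintro ⟨δ, ψ, hψ, h⟩
  obtain rfl := h.sort_eq (r := fun _ => 1) one_ne_zero
  have hx : IsAffineSeq fun m : ℕ => testPoint hd fun _ : Fin 1 => (m : F) :=
    isAffineSeq_testPoint hd (a := 0) (b := 1) fun m k => by simp
  have hinf : {m : ℕ | ψ.Holds (testPoint hd fun _ : Fin 1 => (m : F))}.Infinite :=
    (Set.finite_singleton 0).infinite_compl.mono fun m hm =>
      (h.holds_testPoint_iff _).2 (Nat.cast_ne_zero.2 hm)
  exact (h.holds_testPoint_iff _).1 (hψ.holds_of_infinite hx hinf 0) Nat.cast_zero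

theorem not_defines_of_isLiteralConj (hd : 3 ≤ d) :
    ¬ ∃ (δ : (Fin d × Fin d) ⊕ Fin 2 → Fin (d + 1)) (ψ : Fml d _ fun v => Srt.gr (δ v)),
      ψ.IsLiteralConj ∧
        ψ.Defines (theta (MSet (F := F) hd fun x : Fin 2 → F => (x 0 = 0 ↔ x 1 = 0))) := by
  rintro ⟨δ, ψ, hψ, h⟩
  obtain rfl := h.sort_eq (r := fun _ => 0) Iff.rfl
  have key := hψ.finite_not_holds (F := F) (x := fun n m => testPoint hd ![(n : F), m])
    (isAffineSeq_testPoint hd (a := 0) (b := ![1, 0]) fun m k => by fin_cases k <;> simp)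
    (fun n => isAffineSeq_testPoint hd (a := ![n, 0]) (b := ![0, 1]) fun m k => by
      fin_cases k <;> simp)
    ((h.holds_testPoint_iff _).2 (by simp))
    fun n m hn hm => (h.holds_testPoint_iff _).2 (by simp [hn, hm])
  refine ((Set.finite_singleton 0).infinite_compl.mono fun n hn => ?_) key
  intro hn'
  have := (h.holds_testPoint_iff _).1 hn'
  exact hn (by simpa using this)

end Polynomials

/-! ### Invariance under field automorphisms and wild automorphisms of `ℂ` -/

section Automorphisms

variable {F : Type*} [Field F] {d : ℕ}

/-- Applying `σ` entrywise is a semilinear bijection between the column spaces. -/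
theorem rank_map_ringEquiv (σ : F ≃+* F) (A : Matrix (Fin d) (Fin d) F) :
    (A.map σ).rank = A.rank := by
  have hmem : ∀ (τ : F ≃+* F) (B : Matrix (Fin d) (Fin d) F), ∀ x ∈ LinearMap.range B.mulVecLin,
      (fun i => τ (x i)) ∈ LinearMap.range (B.map τ).mulVecLin := by
    rintro τ B _ ⟨y, rfl⟩
    exact ⟨fun i => τ (y i), funext fun i => (RingHom.map_mulVec τ.toRingHom B y i).symm⟩
  have hsymm : (A.map σ).map σ.symm = A := by ext; simp
  let j : LinearMap.range A.mulVecLin ≃+ LinearMap.range (A.map σ).mulVecLin :=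
    { toFun := fun x => ⟨fun i => σ (x.1 i), hmem σ A x.1 x.2⟩
      invFun := fun x => ⟨fun i => σ.symm (x.1 i), by
        have := hmem σ.symm _ x.1 x.2
        rwa [hsymm] at this⟩
      left_inv := fun x => Subtype.ext <| funext fun i => σ.symm_apply_apply _
      right_inv := fun x => Subtype.ext <| funext fun i => σ.apply_symm_apply _
      map_add' := fun x y => Subtype.ext <| funext fun i => map_add σ _ _ }
  have h := rank_eq_of_equiv_equiv σ j σ.bijective fun c x =>
    Subtype.ext <| funext fun i => map_mul σ _ _
  rw [Matrix.rank, Matrix.rank, Module.finrank, Module.finrank, h]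

theorem Grass.map (σ : F ≃+* F) {k : ℕ} {r : (Fin k ↪o Fin d) → F} (hr : r ∈ Grass F d k) :
    (fun i => σ (r i)) ∈ Grass F d k := by
  obtain ⟨A, hA, hr⟩ := hr
  refine ⟨A.map σ, (rank_map_ringEquiv σ A).trans hA, ?_⟩
  rw [plueckerSet] at hr ⊢
  split_ifs at hr ⊢ with hk
  · obtain rfl : r = 0 := hr
    exact funext fun _ => map_zero σ
  · obtain ⟨hr, hr0⟩ := hr
    refine ⟨?_, fun h => hr0 (funext fun i => ?_)⟩
    · clear hr0
      induction hr using Submodule.span_induction with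
      | mem r h =>
        obtain ⟨j, rfl⟩ := h
        refine Submodule.subset_span ⟨j, funext fun i => ?_⟩
        exact (RingHom.map_det σ.toRingHom _).symm
      | zero => simp only [Pi.zero_apply, map_zero]; exact Submodule.zero_mem _
      | add r s _ _ h1 h2 => simp only [Pi.add_apply, map_add]; exact Submodule.add_mem _ h1 h2
      | smul c r _ h =>
        simp only [Pi.smul_apply, smul_eq_mul, map_mul]; exact Submodule.smul_mem _ (σ c) h
    · exact (map_eq_zero σ).1 (congrFun h i)

/-- The action of a field automorphism on the structure `Γ^d(F)`. -/
def Srt.mapDom (σ : F ≃+* F) : (q : Srt d) → q.Dom F → q.Dom F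
  | .scalar, x => ⟨fun i => σ (x.1 i), trivial⟩
  | .gr _, x => ⟨fun i => σ (x.1 i), Grass.map σ x.2⟩

theorem Srt.mapDom_apply (σ : F ≃+* F) (q : Srt d) (x : q.Dom F) (c : q.Coord) :
    (q.mapDom σ x).1 c = σ (x.1 c) := by
  cases q <;> rfl

theorem Srt.mapDom_surjective (σ : F ≃+* F) (q : Srt d) : Function.Surjective (q.mapDom σ) :=
  fun y => ⟨q.mapDom σ.symm y, Subtype.ext <| funext fun c => by
    rw [Srt.mapDom_apply, Srt.mapDom_apply, RingEquiv.apply_symm_apply]⟩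

theorem extend_mapDom (σ : F ≃+* F) {V : Type} {s : V → Srt d} {q : Srt d} (a : q.Dom F)
    (x : ∀ v, (s v).Dom F) :
    extend (q.mapDom σ a) (fun v => (s v).mapDom σ (x v))
      = fun o => Srt.mapDom σ _ (extend a x o) := by
  funext o
  cases o <;> rfl

variable [StarRing F]

/-- Integer coefficients are fixed by `σ`, and quantifiers are respected because `σ` acts
surjectively on every sort. -/
theorem Fml.InvolutionFree.holds_mapDom_iff (σ : F ≃+* F) {V : Type} {s : V → Srt d}
    {ψ : Fml d V s} (hψ : ψ.InvolutionFree) (x : ∀ v, (s v).Dom F) :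
    ψ.Holds (fun v => (s v).mapDom σ (x v)) ↔ ψ.Holds x := by
  induction ψ with
  | eqn p =>
    obtain ⟨q, rfl⟩ := hψ
    simp only [Fml.Holds, StarPoly.value, MvPolynomial.eval₂_rename, Sum.elim_comp_inl,
      Srt.mapDom_apply]
    have h := MvPolynomial.hom_eval₂ q (Int.castRingHom F) σ.toRingHom
      fun c => (x c.1).1 c.2
    rw [RingHom.ext_int (σ.toRingHom.comp (Int.castRingHom F)) (Int.castRingHom F)] at h
    exact (iff_of_eq (congrArg (· = 0) h.symm)).trans (map_eq_zero σ)
  | neg ψ ih => exact not_congr (ih hψ x)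
  | and ψ χ ih1 ih2 => exact and_congr (ih1 hψ.1 x) (ih2 hψ.2 x)
  | or ψ χ ih1 ih2 => exact or_congr (ih1 hψ.1 x) (ih2 hψ.2 x)
  | all q ψ ih =>
    simp only [Fml.Holds]
    rw [(Srt.mapDom_surjective σ q).forall]
    refine forall_congr' fun a => ?_
    rw [extend_mapDom]
    exact ih hψ _
  | ex q ψ ih =>
    simp only [Fml.Holds]
    rw [(Srt.mapDom_surjective σ q).exists]
    refine exists_congr fun a => ?_
    rw [extend_mapDom]
    exact ih hψ _

omit [StarRing F] in
theorem mapDom_testPoint (σ : F ≃+* F) (hd : 3 ≤ d) {n : ℕ} (r : Fin n → F) :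
    (fun v => (Srt.gr (pointIdx hd)).mapDom σ (testPoint hd r v))
      = testPoint hd fun k => σ (r k) := by
  have hs : ∀ i j : Fin d, σ ((Pi.single i 1 : Fin d → F) j) = (Pi.single i 1 : Fin d → F) j := by
    intro i j
    by_cases h : j = i
    · subst h; simp
    · simp [Pi.single_eq_of_ne h]
  funext v
  refine Subtype.ext (funext fun c => ?_)
  rw [Srt.mapDom_apply]
  rcases v with p | k
  · simp only [testPoint, testVec]
    split_ifs <;> simp [hs]
  · simp [testPoint, testVec, hs]

/-- A permutation of the variables is an automorphism of the polynomial subring, and extends to its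
algebraic closure `K`. -/
theorem exists_ringEquiv_perm_of_isTranscendenceBasis {ι R K : Type*} [CommRing R] [Field K]
    [Algebra R K] [IsAlgClosed K] {x : ι → K} (hx : IsTranscendenceBasis R x) (π : Equiv.Perm ι) :
    ∃ σ : K ≃+* K, ∀ i, σ (x i) = x (π i) := by
  have := IsAlgClosed.isAlgClosure_of_transcendence_basis x hx
  let e : Algebra.adjoin R (Set.range x) ≃+* Algebra.adjoin R (Set.range x) :=
    ((hx.1.aevalEquiv.symm.trans (MvPolynomial.renameEquiv R π)).trans
      hx.1.aevalEquiv).toRingEquiv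
  have hX : ∀ i, x i
      = algebraMap (Algebra.adjoin R (Set.range x)) K (hx.1.aevalEquiv (MvPolynomial.X i)) :=
    fun i => by rw [hx.1.algebraMap_aevalEquiv, MvPolynomial.aeval_X]
  refine ⟨IsAlgClosure.equivOfEquiv K K e, fun i => ?_⟩
  rw [hX i, IsAlgClosure.equivOfEquiv_algebraMap, hX (π i)]
  simp [e]

/-- Commuting with conjugation makes `σ` preserve `ℝ`, whose only ring endomorphism is the identity;
so `σ` is `ℝ`-linear. -/
theorem ringEquiv_eq_self_or_star {σ : ℂ ≃+* ℂ} (h : ∀ z, σ (star z) = star (σ z)) :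
    (∀ z, σ z = z) ∨ ∀ z, σ z = star z := by
  have hre : ∀ t : ℝ, ((σ t).re : ℂ) = σ t := fun t => by
    refine Complex.conj_eq_iff_re.1 ?_
    have := h t
    rw [Complex.star_def, Complex.conj_ofReal] at this
    exact this.symm
  let τ : ℝ →+* ℝ :=
    { toFun := fun t => (σ t).re
      map_one' := by simp
      map_zero' := by simp
      map_add' := fun s t => by simp
      map_mul' := fun s t => by
        apply Complex.ofReal_injective
        rw [hre, Complex.ofReal_mul, Complex.ofReal_mul, hre, hre, map_mul] }
  have hτ : ∀ t : ℝ, σ t = t := fun t => by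
    rw [← hre t]
    exact congrArg _ (RingHom.congr_fun (Subsingleton.elim τ (RingHom.id ℝ)) t)
  let f : ℂ →ₐ[ℝ] ℂ := { σ.toRingHom with commutes' := hτ }
  exact (Complex.real_algHom_eq_id_or_conj f).imp (fun hf z => DFunLike.congr_fun hf z)
    fun hf z => DFunLike.congr_fun hf z

/-- Otherwise identity and conjugation are the only automorphisms. Swapping `x i` with any other
member `x l` of a transcendence basis then forces `x l = star (x i)`, impossible for two distinct
`l`. -/
theorem exists_ringEquiv_star_ne : ∃ (σ : ℂ ≃+* ℂ) (z : ℂ), σ (star z) ≠ star (σ z) := by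
  obtain ⟨ι, x, hx⟩ := exists_isTranscendenceBasis' ℚ ℂ
  have hcard : Cardinal.mk ℂ = Cardinal.mk ι :=
    IsAlgClosed.cardinal_eq_cardinal_transcendence_basis_of_aleph0_lt' x hx
      Cardinal.mkRat.le (by rw [Cardinal.mk_complex]; exact Cardinal.aleph0_lt_continuum)
  have : Infinite ι := by
    rw [Cardinal.infinite_iff, ← hcard, Cardinal.mk_complex]
    exact Cardinal.aleph0_le_continuum
  by_contra! hstar
  classical
  have hinj : Function.Injective x := hx.1.injective
  obtain ⟨i⟩ : Nonempty ι := inferInstance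
  obtain ⟨j, hj⟩ := Infinite.exists_notMem_finset ({i} : Finset ι)
  obtain ⟨k, hk⟩ := Infinite.exists_notMem_finset ({i, j} : Finset ι)
  simp only [Finset.mem_insert, Finset.mem_singleton, not_or] at hj hk
  have key : ∀ l, l ≠ i → x l = star (x i) := by
    intro l hl
    obtain ⟨σ, hσ⟩ := exists_ringEquiv_perm_of_isTranscendenceBasis hx (Equiv.swap i l)
    have hi := hσ i
    rw [Equiv.swap_apply_left] at hi
    rcases ringEquiv_eq_self_or_star (hstar σ) with h | h
    · exact (hl (hinj (by rw [← hi, h]))).elim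
    · rw [← hi, h]
  exact hk.2 (hinj ((key k hk.1).trans (key j hj).symm))

theorem not_defines_of_involutionFree (hd : 3 ≤ d) :
    ¬ ∃ (δ : (Fin d × Fin d) ⊕ Fin 2 → Fin (d + 1)) (ψ : Fml d _ fun v => Srt.gr (δ v)),
      ψ.InvolutionFree ∧
        ψ.Defines (theta (MSet (F := ℂ) hd fun x : Fin 2 → ℂ => x 1 = star (x 0))) := by
  rintro ⟨δ, ψ, hψ, h⟩
  obtain rfl := h.sort_eq (r := fun _ => 0) (star_zero ℂ).symm
  obtain ⟨σ, z, hz⟩ := exists_ringEquiv_star_ne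
  have h1 : ψ.Holds (testPoint hd ![z, star z]) := (h.holds_testPoint_iff _).2 rfl
  -- Invariance moves the pair `(z, z^*)` to `(σ z, σ (z^*))`, which violates the condition.
  rw [← hψ.holds_mapDom_iff σ, mapDom_testPoint, h.holds_testPoint_iff] at h1
  exact hz h1

end Automorphisms

end FrameDef

theorem mainTheorem9 {F : Type*} [Field F] [StarRing F]
    (ι : F →+* ℂ) (hι : ∀ x : F, ι (star x) = star (ι x)) (d : ℕ) (hd : 3 ≤ d) :
    (¬ ∃ (δ : (Fin d × Fin d) ⊕ Fin 1 → Fin (d + 1)) (ψ : Fml d _ fun v => Srt.gr (δ v)),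
      ψ.IsQFPositive ∧ ψ.Defines (theta (MSet (F := F) hd fun x : Fin 1 → F => x 0 ≠ 0))) ∧
    (¬ ∃ (δ : (Fin d × Fin d) ⊕ Fin 2 → Fin (d + 1)) (ψ : Fml d _ fun v => Srt.gr (δ v)),
      ψ.IsLiteralConj ∧
        ψ.Defines (theta (MSet (F := F) hd fun x : Fin 2 → F => (x 0 = 0 ↔ x 1 = 0)))) ∧
    (¬ ∃ (δ : (Fin d × Fin d) ⊕ Fin 2 → Fin (d + 1)) (ψ : Fml d _ fun v => Srt.gr (δ v)),
      ψ.InvolutionFree ∧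
        ψ.Defines (theta (MSet (F := ℂ) hd fun x : Fin 2 → ℂ => x 1 = star (x 0)))) ∧
    DefinedByEquation (MSet (F := F) hd fun x : Fin 1 → F => x 0 ≠ 0) ∧
    DefinedByEquation (MSet (F := F) hd fun x : Fin 2 → F => (x 0 = 0 ↔ x 1 = 0)) ∧
    DefinedByEquation (MSet (F := F) hd fun x : Fin 2 → F => x 1 = star (x 0)) ∧
    DefinedByEquation (MSet (F := ℂ) hd fun x : Fin 2 → ℂ => x 1 = star (x 0)) := by
  have : CharZero F := RingHom.charZero ι
  have hF : Anisotropic F d := anisotropic_of_embedding ι hι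
  have hC : Anisotropic ℂ d := anisotropic_of_embedding (RingHom.id ℂ) fun _ => rfl
  exact ⟨not_defines_of_isQFPositive hd, not_defines_of_isLiteralConj hd,
    not_defines_of_involutionFree hd, definedByEquation_ne_zero hF hd,
    definedByEquation_zero_iff_zero hF hd, definedByEquation_star hF hd,
    definedByEquation_star hC hd⟩
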